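/- Let $G$ be a connected (simple, finite or infinite, not necessarily countable) graph. A ray is a one-way infinite path in $G$; two rays are edge-equivalent if for every finite set $F$ of edges they have tails in the same component of $G-F$, and the equivalence classes of rays are the edge-ends of $G$; their set is $\Omega'(G)$. An edge-end lives in a component $K$ of $G-F$ ($F$ a finite set of edges) if $K$ contains one of its rays. Let $\Vert G\Vert$ be the point set of the geometric realization of $G$, that is, the vertices together with the inner points of the edges, each open edge being a copy of $(0,1)$. The topology ETop on $\Vert G\Vert\cup\Omega'(G)$ is generated by the open subsets of the open edges and the following sets: for every finite set $X$ of inner points of edges and every component $K$ of the graph obtained from $G$ by deleting the edges that meet $X$, the component of $\Vert G\Vert\setminus X$ that contains $K$, together with all edge-ends that live in $K$. The space $\widetilde G$ (with the topology ITop) is the quotient of this space obtained by identifying any two points that have the same open neighbourhoods. A standard subspace of $\widetilde G$ is the closure in $\widetilde G$ of some subgraph of $G$. A finite cut of $G$ is a partition $V(G)=A\cup B$, $A\cap B=\emptyset$, into two sides $A,B$ such that the set of edges between $A$ and $B$ is finite; its edges are the edges between $A$ and $B$. A set $H\subseteq\widetilde G$ meets the side $A$ if $H$ contains the point of $\widetilde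 G$ given by some vertex in $A$. A subspace $H$ is arc-connected if any two distinct points of $H$ are the endpoints of an arc in $H$, where an arc is a subspace homeomorphic to $[0,1]$. Then a standard subspace $H$ of $\widetilde G$ is arc-connected if and only if $H$ contains an edge from every finite cut of $G$ both sides of which it meets. -/

import Mathlib

namespace EdgeEnds

universe u

variable {V : Type u} (G : SimpleGraph V)

/-- A ray: a one-way infinite path `R 0, R 1, R 2, …` of `G`. -/
structure Ray where
  toFun : ℕ → V
  injective : Function.Injective toFun
  adj : ∀ n, G.Adj (toFun n) (toFun (n + 1))

/-- The component `K` of `G - F` contains (all vertices of) a tail of the ray `R`. -/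
def Ray.HasTailIn {G : SimpleGraph V} (R : Ray G) {F : Set (Sym2 V)}
    (K : (G.deleteEdges F).ConnectedComponent) : Prop :=
  ∃ m, ∀ n, m ≤ n → R.toFun n ∈ K.supp

/-- Two rays are edge-equivalent if for every finite set `F` of edges they have
tails in the same component of `G - F`. -/
def Ray.EdgeEquiv {G : SimpleGraph V} (R₁ R₂ : Ray G) : Prop :=
  ∀ F : Set (Sym2 V), F ⊆ G.edgeSet → F.Finite →
    ∃ K : (G.deleteEdges F).ConnectedComponent, R₁.HasTailIn K ∧ R₂.HasTailIn K

theorem Ray.edge_injective {G : SimpleGraph V} (R : Ray G) :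
    Function.Injective fun n => s(R.toFun n, R.toFun (n + 1)) := by
  intro a b h
  simp only [Sym2.eq_iff, R.injective.eq_iff] at h
  omega

theorem Ray.exists_hasTailIn {G : SimpleGraph V} (R : Ray G) {F : Set (Sym2 V)}
    (hF : F.Finite) : ∃ K : (G.deleteEdges F).ConnectedComponent, R.HasTailIn K := by
  have hfin : {n | s(R.toFun n, R.toFun (n + 1)) ∈ F}.Finite :=
    hF.preimage R.edge_injective.injOn
  obtain ⟨m, hm⟩ := hfin.bddAbove
  refine ⟨(G.deleteEdges F).connectedComponentMk (R.toFun (m + 1)), m + 1, fun n hn => ?_⟩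
  induction n, hn using Nat.le_induction with
  | base => rfl
  | succ n hn ih =>
    rw [SimpleGraph.ConnectedComponent.mem_supp_iff] at ih ⊢
    rw [← ih, SimpleGraph.ConnectedComponent.eq]
    refine (SimpleGraph.Adj.reachable ?_).symm
    rw [SimpleGraph.deleteEdges_adj]
    refine ⟨R.adj n, fun hmem => ?_⟩
    have : n ≤ m := hm hmem
    omega

theorem Ray.edgeEquiv_equivalence : Equivalence (Ray.EdgeEquiv (G := G)) where
  refl R F _ hF := by
    obtain ⟨K, hK⟩ := R.exists_hasTailIn hF
    exact ⟨K, hK, hK⟩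
  symm h F hFG hF := by
    obtain ⟨K, h₁, h₂⟩ := h F hFG hF
    exact ⟨K, h₂, h₁⟩
  trans h h' F hFG hF := by
    obtain ⟨K, h₁, m, hm⟩ := h F hFG hF
    obtain ⟨K', ⟨m', hm'⟩, h₂⟩ := h' F hFG hF
    have e : K = K' := by
      have a := hm (max m m') (le_max_left _ _)
      have b := hm' (max m m') (le_max_right _ _)
      rw [SimpleGraph.ConnectedComponent.mem_supp_iff] at a b
      exact a.symm.trans b
    subst e
    exact ⟨K, h₁, h₂⟩

instance raySetoid : Setoid (Ray G) := ⟨Ray.EdgeEquiv, Ray.edgeEquiv_equivalence G⟩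

/-- The edge-ends of `G`: the edge-equivalence classes of rays. -/
def EdgeEnd : Type u := Quotient (raySetoid G)

/-- The edge-end `ω` lives in the component `K` of `G - F` if `K` contains a ray of `ω`. -/
def EdgeEnd.LivesIn {G : SimpleGraph V} (ω : EdgeEnd G) {F : Set (Sym2 V)}
    (K : (G.deleteEdges F).ConnectedComponent) : Prop :=
  ∃ R : Ray G, Quotient.mk (raySetoid G) R = ω ∧ ∀ n, R.toFun n ∈ K.supp

/-- The two endvertices of an edge, in an arbitrary but fixed order. -/
noncomputable def source {G : SimpleGraph V} (e : G.edgeSet) : V := (Quot.out e.1).1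

/-- See `source`. -/
noncomputable def target {G : SimpleGraph V} (e : G.edgeSet) : V := (Quot.out e.1).2

theorem mk_source_target {G : SimpleGraph V} (e : G.edgeSet) :
    s(source e, target e) = e.1 :=
  Quot.out_eq e.1

/-- The points of the geometric realization of `G` (its vertices and the inner points of its
edges), together with the edge-ends of `G`. The point `inner e t` is the inner point at
distance `t` from `source e` on the edge `e`, seen as a copy of the unit interval that runs
from `source e` to `target e`. -/
inductive Point : Type u
  | vertex (v : V) : Point
  | inner (e : G.edgeSet) (t : Set.Ioo (0 : ℝ) 1) : Point
  | edgeEnd (ω : EdgeEnd G) : Point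

/-- The edges that have an inner point in `X`. -/
def edgesOf {G : SimpleGraph V} (X : Set (G.edgeSet × Set.Ioo (0 : ℝ) 1)) : Set (Sym2 V) :=
  {f | ∃ p ∈ X, p.1.1 = f}

/-- For a finite set `X` of inner points of edges and a component `K` of the graph obtained by
deleting the edges that meet `X`: the component of the realization minus `X` that contains `K`
(that is, `K` with its edges, and the partial edges from a vertex of `K` up to the first point
of `X` on that edge), together with the edge-ends that live in `K`. -/
def basicOpen {G : SimpleGraph V} (X : Set (G.edgeSet × Set.Ioo (0 : ℝ) 1))
    (K : (G.deleteEdges (edgesOf X)).ConnectedComponent) : Set (Point G) :=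
  {p | match p with
    | .vertex v => v ∈ K.supp
    | .inner e t =>
        (source e ∈ K.supp ∧ ∀ s, (e, s) ∈ X → t < s) ∨
        (target e ∈ K.supp ∧ ∀ s, (e, s) ∈ X → s < t)
    | .edgeEnd ω => ω.LivesIn K}

/-- The topology ETop: it is generated by the open subsets of the open edges and the
sets `basicOpen X K`. -/
instance eTop : TopologicalSpace (Point G) :=
  TopologicalSpace.generateFrom
    ({O | ∃ (e : G.edgeSet) (U : Set (Set.Ioo (0 : ℝ) 1)), IsOpen U ∧ O = Point.inner e '' U} ∪
     {O | ∃ (X : Set (G.edgeSet × Set.Ioo (0 : ℝ) 1))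
        (K : (G.deleteEdges (edgesOf X)).ConnectedComponent), X.Finite ∧ O = basicOpen X K})

/-- The space `G̃` with the topology ITop: the quotient of ETop that identifies any two points
with the same open neighbourhoods. -/
abbrev GTilde : Type u := SeparationQuotient (Point G)

variable {G}

/-- The point of `G̃` given by a vertex. -/
def vertexPt (v : V) : GTilde G := SeparationQuotient.mk (Point.vertex v)

/-- The set of points of `G̃` on the (closed) edge `e`. -/
def edgePts (e : G.edgeSet) : Set (GTilde G) :=
  {vertexPt (source e), vertexPt (target e)} ∪
    Set.range fun t => SeparationQuotient.mk (Point.inner e t)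

/-- The set of points of `G̃` given by the vertices and the edges of a subgraph. -/
def subgraphPts (S : G.Subgraph) : Set (GTilde G) :=
  vertexPt '' S.verts ∪ ⋃ (e : G.edgeSet) (_ : e.1 ∈ S.edgeSet), edgePts e

/-- A standard subspace of `G̃`: the closure of some subgraph of `G`. -/
def IsStandardSubspace (H : Set (GTilde G)) : Prop :=
  ∃ S : G.Subgraph, H = closure (subgraphPts S)

/-- The edges of `G` between `A` and `B`. -/
def cutEdges (G : SimpleGraph V) (A B : Set V) : Set (Sym2 V) :=
  {f | f ∈ G.edgeSet ∧ ∃ a ∈ A, ∃ b ∈ B, f = s(a, b)}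

/-- `A` and `B` are the two sides of a finite cut of `G`: they partition the vertex set, and
there are only finitely many edges between them. -/
def IsFiniteCut (G : SimpleGraph V) (A B : Set V) : Prop :=
  A ∩ B = ∅ ∧ A ∪ B = Set.univ ∧ (cutEdges G A B).Finite

/-- A subset of a topological space is arc-connected if any two distinct points of it are
joined in it by an arc, that is, by a homeomorphic image of `[0, 1]`. -/
def IsArcConnected {Y : Type*} [TopologicalSpace Y] (H : Set Y) : Prop :=
  ∀ x ∈ H, ∀ y ∈ H, x ≠ y →
    ∃ γ : unitInterval → Y, Topology.IsEmbedding γ ∧ γ 0 = x ∧ γ 1 = y ∧ Set.range γ ⊆ H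

end EdgeEnds

/-! If `H` contains no edge of a finite cut both of whose sides it meets, then, `H` being closed,
every cut edge has an inner point outside `H`. Removing one such point from each cut edge leaves two
disjoint open sets that cover `H`, and an arc in `H` between vertices on different sides would be a
connected set meeting both (`exists_edgePts_subset_of_isArcConnected`).

For the converse, finite cuts are treated as the coordinates of the space. Every vertex and every
edge-end (a node) has an ultrafilter `track` on the vertices that records its side of each finite
cut, and nodes with the same sides of all finite cuts are inseparable. The space of points is
compact, since every ultrafilter on the vertices agrees on finite cuts with some node
(`exists_isNode_track`, a ray construction), and its quotient is Hausdorff.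

Let `p` and `q` be nodes in a standard subspace `H`. By hypothesis the edges of `H` meet every
finite cut separating `p` from `q`. Cuts being finite, Zorn's lemma gives a minimal set `M` of edges
of `H` with this property, and by minimality each `e ∈ M` is the only edge of `M` in some finite cut
`A e` separating `p` from `q` (`Connects.exists_isCutSystem`). The nodes not separated from `p` by a
finite cut avoiding `M`, together with the open edges of `M`, form a closed set, the `thread`, whose
image lies in `H`. On it the cuts `A e` tell points apart (`exists_not_iff`, `exists_cutFun_ne`) and
are nested (`not_crossing`), so they order it linearly.

An ultralimit of cuts shows that `M` is countable, so it has positive summable weights. The weighted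
sum of the interpolated indicators of the cuts is continuous, and on the thread it is injective up
to inseparability. Its image is compact, lies in an interval whose length is the total weight, and
contains disjoint open intervals of that same total length, one per edge of `M`; so it is the whole
interval (`image_weight`). By compactness the inverse is continuous and parametrises the required
arc (`arcJoined_of_connects`). Inner points of edges are first joined to an end of their edge, and
arcs are concatenated. -/

open Filter Topology

namespace EdgeEnds

universe u

variable {V : Type u} {G : SimpleGraph V}

/-! ### Edge boundaries and finite cuts -/

/-- The edges of `G` with exactly one end in `A`. -/
def boundary (G : SimpleGraph V) (A : Set V) : Set G.edgeSet :=
  {e | ¬(source e ∈ A ↔ target e ∈ A)}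

theorem mem_boundary {A : Set V} {e : G.edgeSet} :
    e ∈ boundary G A ↔ ¬(source e ∈ A ↔ target e ∈ A) := Iff.rfl

theorem mk_mem_boundary {A : Set V} {a b : V} (h : G.Adj a b) :
    (⟨s(a, b), h⟩ : G.edgeSet) ∈ boundary G A ↔ ¬(a ∈ A ↔ b ∈ A) := by
  have := mk_source_target (⟨s(a, b), h⟩ : G.edgeSet)
  rw [mem_boundary]
  rcases Sym2.eq_iff.1 this with ⟨h₁, h₂⟩ | ⟨h₁, h₂⟩
  · rw [h₁, h₂]
  · rw [h₁, h₂]; tauto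

theorem boundary_compl (A : Set V) : boundary G Aᶜ = boundary G A := by
  ext e; simp only [mem_boundary, Set.mem_compl_iff]; tauto

theorem boundary_inter_subset (A B : Set V) :
    boundary G (A ∩ B) ⊆ boundary G A ∪ boundary G B := by
  intro e; simp only [mem_boundary, Set.mem_inter_iff, Set.mem_union]; tauto

theorem boundary_union_subset (A B : Set V) :
    boundary G (A ∪ B) ⊆ boundary G A ∪ boundary G B := by
  intro e; simp only [mem_boundary, Set.mem_union]; tauto

theorem boundary_diff_subset (A B : Set V) :
    boundary G (A \ B) ⊆ boundary G A ∪ boundary G B := by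
  intro e; simp only [mem_boundary, Set.mem_union, Set.mem_sdiff]; tauto

theorem mem_boundary_symmDiff {A B : Set V} {e : G.edgeSet} :
    e ∈ boundary G (symmDiff A B) ↔ ¬(e ∈ boundary G A ↔ e ∈ boundary G B) := by
  simp only [mem_boundary, Set.mem_symmDiff]; tauto

theorem boundary_symmDiff_subset (A B : Set V) :
    boundary G (symmDiff A B) ⊆ boundary G A ∪ boundary G B := by
  intro e; rw [mem_boundary_symmDiff]; simp only [Set.mem_union]; tauto

theorem image_boundary (A : Set V) :
    Subtype.val '' boundary G A = cutEdges G A Aᶜ := by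
  ext f
  constructor
  · rintro ⟨e, he, rfl⟩
    refine ⟨e.2, ?_⟩
    rw [mem_boundary] at he
    by_cases hs : source e ∈ A
    · exact ⟨_, hs, target e, fun h => he ⟨fun _ => h, fun _ => hs⟩, (mk_source_target e).symm⟩
    · refine ⟨target e, by tauto, source e, hs, ?_⟩
      rw [Sym2.eq_swap, mk_source_target]
  · rintro ⟨hf, a, ha, b, hb, rfl⟩
    exact ⟨⟨_, hf⟩, (mk_mem_boundary hf).2 fun h => hb (h.1 ha), rfl⟩

theorem finite_cutEdges_iff (A : Set V) :
    (cutEdges G A Aᶜ).Finite ↔ (boundary G A).Finite := by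
  rw [← image_boundary, Set.finite_image_iff Subtype.val_injective.injOn]

theorem mem_iff_mem_of_reachable {F : Set (Sym2 V)} {A : Set V}
    (hF : ∀ e ∈ boundary G A, e.1 ∈ F) {u v : V} (h : (G.deleteEdges F).Reachable u v) :
    u ∈ A ↔ v ∈ A := by
  obtain ⟨p⟩ := h
  induction p with
  | nil => rfl
  | cons h _ ih =>
    rw [SimpleGraph.deleteEdges_adj] at h
    rw [← ih]
    by_contra hc
    exact h.2 (hF _ ((mk_mem_boundary h.1).2 hc))

theorem supp_subset {F : Set (Sym2 V)} {A : Set V} (hF : ∀ e ∈ boundary G A, e.1 ∈ F)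
    {K : (G.deleteEdges F).ConnectedComponent} {v : V} (hv : v ∈ K.supp) (hA : v ∈ A) :
    K.supp ⊆ A := by
  intro w hw
  rw [SimpleGraph.ConnectedComponent.mem_supp_iff] at hv hw
  exact (mem_iff_mem_of_reachable hF
    (SimpleGraph.ConnectedComponent.exact (hv.trans hw.symm))).1 hA

theorem boundary_supp {F : Set (Sym2 V)} (K : (G.deleteEdges F).ConnectedComponent) :
    ∀ e ∈ boundary G K.supp, e.1 ∈ F := by
  intro e he
  by_contra hF
  refine he ?_
  have hadj : (G.deleteEdges F).Adj (source e) (target e) := by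
    rw [SimpleGraph.deleteEdges_adj]
    refine ⟨?_, by rwa [mk_source_target]⟩
    have := e.2
    rwa [← mk_source_target e, SimpleGraph.mem_edgeSet] at this
  exact K.mem_supp_congr_adj hadj

/-! ### Points as ultrafilters on the vertex set -/

/-- A sequence of vertices that represents a point: a ray of an edge-end, and a constant sequence
for all other points. -/
noncomputable def vertexSeq : Point G → ℕ → V
  | .vertex v, _ => v
  | .inner e _, _ => source e
  | .edgeEnd ω, n => (Quotient.out (s := raySetoid G) ω).toFun n

/-- An ultrafilter on the vertices that contains the sides of the finite cuts on which the
point lies. -/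
noncomputable def track (p : Point G) : Ultrafilter V := (hyperfilter ℕ).map (vertexSeq p)

@[simp] theorem mem_track_vertex {v : V} {A : Set V} :
    A ∈ track (Point.vertex v : Point G) ↔ v ∈ A := by
  rw [track, ← Ultrafilter.mem_coe, Ultrafilter.coe_map]
  exact Filter.eventually_const (p := v ∈ A) (f := (hyperfilter ℕ : Filter ℕ))

@[simp] theorem mem_track_inner {e : G.edgeSet} {t : Set.Ioo (0 : ℝ) 1} {A : Set V} :
    A ∈ track (Point.inner e t) ↔ source e ∈ A := by
  rw [track, ← Ultrafilter.mem_coe, Ultrafilter.coe_map]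
  exact Filter.eventually_const (p := source e ∈ A) (f := (hyperfilter ℕ : Filter ℕ))

theorem mem_track_of_eventually {p : Point G} {A : Set V} (h : ∀ᶠ n in atTop, vertexSeq p n ∈ A) :
    A ∈ track p := by
  rw [track, Ultrafilter.mem_map]
  rw [← Nat.cofinite_eq_atTop] at h
  exact hyperfilter_le_cofinite h

/-- A ray has a tail in one component of the graph minus the finite cut, and such a component lies
on one side. Hence on finite cuts the choice of the hyperfilter in `track` is immaterial. -/
theorem Ray.eventually_mem_or (R : Ray G) {A : Set V} (hA : (boundary G A).Finite) :
    (∀ᶠ n in atTop, R.toFun n ∈ A) ∨ ∀ᶠ n in atTop, R.toFun n ∉ A := by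
  obtain ⟨K, m, hm⟩ := R.exists_hasTailIn (hA.image Subtype.val)
  have hF : ∀ e ∈ boundary G A, e.1 ∈ Subtype.val '' boundary G A := fun e he => ⟨e, he, rfl⟩
  by_cases h : R.toFun m ∈ A
  · exact Or.inl (eventually_atTop.2 ⟨m, fun n hn => supp_subset hF (hm m le_rfl) h (hm n hn)⟩)
  · refine Or.inr (eventually_atTop.2 ⟨m, fun n hn => ?_⟩)
    exact supp_subset (A := Aᶜ) (by rwa [boundary_compl]) (hm m le_rfl) h (hm n hn)

theorem mem_track_iff_eventually {p : Point G} {A : Set V} (hA : (boundary G A).Finite) :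
    A ∈ track p ↔ ∀ᶠ n in atTop, vertexSeq p n ∈ A := by
  refine ⟨fun h => ?_, mem_track_of_eventually⟩
  have key : (∀ᶠ n in atTop, vertexSeq p n ∈ A) ∨ ∀ᶠ n in atTop, vertexSeq p n ∉ A := by
    cases p with
    | vertex v => by_cases h : v ∈ A <;> simp [vertexSeq, h]
    | inner e t => by_cases h : source e ∈ A <;> simp [vertexSeq, h]
    | edgeEnd ω => exact Ray.eventually_mem_or _ hA
  refine key.resolve_right fun hc => ?_
  exact Ultrafilter.compl_mem_iff_notMem.1 (mem_track_of_eventually (A := Aᶜ) hc) h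

theorem Ray.shift_equiv (R : Ray G) (m : ℕ) :
    Quotient.mk (raySetoid G)
      ⟨fun n => R.toFun (m + n), fun a b h => by have := R.injective h; omega,
        fun n => R.adj (m + n)⟩ = Quotient.mk (raySetoid G) R := by
  refine Quotient.sound fun F _ hF => ?_
  obtain ⟨K, k, hk⟩ := R.exists_hasTailIn hF
  exact ⟨K, ⟨k, fun n hn => hk _ (by omega)⟩, k, hk⟩

theorem HasTailIn_unique {R : Ray G} {F : Set (Sym2 V)}
    {K K' : (G.deleteEdges F).ConnectedComponent} (h : R.HasTailIn K) (h' : R.HasTailIn K') :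
    K = K' := by
  obtain ⟨m, hm⟩ := h
  obtain ⟨m', hm'⟩ := h'
  have a := hm (max m m') (le_max_left _ _)
  have b := hm' (max m m') (le_max_right _ _)
  rw [SimpleGraph.ConnectedComponent.mem_supp_iff] at a b
  exact a.symm.trans b

theorem hasTailIn_inter {R : Ray G} {F : Set (Sym2 V)}
    {K : (G.deleteEdges (F ∩ G.edgeSet)).ConnectedComponent} (h : R.HasTailIn K) :
    ∃ K' : (G.deleteEdges F).ConnectedComponent, K'.supp = K.supp ∧ R.HasTailIn K' := by
  have e : G.deleteEdges (F ∩ G.edgeSet) = G.deleteEdges F :=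
    (SimpleGraph.deleteEdges_eq_inter_edgeSet F).symm
  obtain ⟨m, hm⟩ := h
  refine ⟨(G.deleteEdges F).connectedComponentMk (R.toFun m), ?_⟩
  have hs : ((G.deleteEdges F).connectedComponentMk (R.toFun m)).supp = K.supp := by
    ext w
    have h0 := hm m le_rfl
    rw [SimpleGraph.ConnectedComponent.mem_supp_iff] at h0 ⊢
    rw [SimpleGraph.ConnectedComponent.mem_supp_iff, ← h0, SimpleGraph.ConnectedComponent.eq,
      SimpleGraph.ConnectedComponent.eq, e]
  exact ⟨hs, m, fun n hn => hs ▸ hm n hn⟩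

/-- Equivalent rays have tails in the same component, so the chosen ray of `ω` may be used;
conversely a tail of that ray is again a ray of `ω`. -/
theorem livesIn_iff {ω : EdgeEnd G} {F : Set (Sym2 V)} (hF : F.Finite)
    (K : (G.deleteEdges F).ConnectedComponent) :
    ω.LivesIn K ↔ K.supp ∈ track (Point.edgeEnd ω) := by
  have hK : (boundary G K.supp).Finite :=
    Set.Finite.of_finite_image (hF.subset (by rintro _ ⟨e, he, rfl⟩; exact boundary_supp K e he))
      Subtype.val_injective.injOn
  constructor
  · rintro ⟨R, rfl, hR⟩
    have h : Ray.EdgeEquiv (Quotient.out (s := raySetoid G) (Quotient.mk (raySetoid G) R)) R :=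
      Quotient.mk_out (s := raySetoid G) R
    -- `F` may contain pairs that are not edges, while edge-equivalence only tests sets of edges.
    obtain ⟨K₀, h₁, h₂⟩ := h (F ∩ G.edgeSet) Set.inter_subset_right (hF.inter_of_left _)
    obtain ⟨K', hs, h₁'⟩ := hasTailIn_inter h₁
    have h₂' : R.HasTailIn K' := by
      obtain ⟨m, hm⟩ := h₂
      exact ⟨m, fun n hn => hs ▸ hm n hn⟩
    have e : K = K' := HasTailIn_unique ⟨0, fun n _ => hR n⟩ h₂'
    subst e
    obtain ⟨m, hm⟩ := h₁'
    exact mem_track_of_eventually (eventually_atTop.2 ⟨m, hm⟩)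
  · intro h
    rw [mem_track_iff_eventually hK] at h
    obtain ⟨m, hm⟩ := eventually_atTop.1 h
    exact ⟨_, (Ray.shift_equiv (Quotient.out (s := raySetoid G) ω) m).trans (Quotient.out_eq _),
      fun n => hm _ (by omega)⟩

/-! ### Neighbourhoods given by finite cuts -/

/-- The part of the space on the side `A` of a cut whose edges contain points of `X`. -/
def cutOpen (X : Set (G.edgeSet × Set.Ioo (0 : ℝ) 1)) (A : Set V) : Set (Point G) :=
  {p | match p with
    | .vertex v => v ∈ A
    | .inner e t =>
        (source e ∈ A ∧ ∀ s, (e, s) ∈ X → t < s) ∨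
        (target e ∈ A ∧ ∀ s, (e, s) ∈ X → s < t)
    | .edgeEnd ω => A ∈ track (Point.edgeEnd ω)}

@[simp] theorem vertex_mem_cutOpen {X : Set (G.edgeSet × Set.Ioo (0 : ℝ) 1)} {A : Set V} {v : V} :
    (Point.vertex v : Point G) ∈ cutOpen X A ↔ v ∈ A := Iff.rfl

@[simp] theorem edgeEnd_mem_cutOpen {X : Set (G.edgeSet × Set.Ioo (0 : ℝ) 1)} {A : Set V}
    {ω : EdgeEnd G} :
    (Point.edgeEnd ω : Point G) ∈ cutOpen X A ↔ A ∈ track (Point.edgeEnd ω) := Iff.rfl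

theorem inner_mem_cutOpen {X : Set (G.edgeSet × Set.Ioo (0 : ℝ) 1)} {A : Set V}
    {e : G.edgeSet} {t : Set.Ioo (0 : ℝ) 1} :
    (Point.inner e t : Point G) ∈ cutOpen X A ↔
      (source e ∈ A ∧ ∀ s, (e, s) ∈ X → t < s) ∨ (target e ∈ A ∧ ∀ s, (e, s) ∈ X → s < t) :=
  Iff.rfl

theorem finite_edgesOf {X : Set (G.edgeSet × Set.Ioo (0 : ℝ) 1)} (hX : X.Finite) :
    (edgesOf X).Finite :=
  (hX.image fun p => p.1.1).subset (by rintro _ ⟨p, hp, rfl⟩; exact ⟨p, hp, rfl⟩)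

theorem mem_edgesOf {X : Set (G.edgeSet × Set.Ioo (0 : ℝ) 1)} {e : G.edgeSet} :
    e.1 ∈ edgesOf X ↔ e ∈ Prod.fst '' X := by
  constructor
  · rintro ⟨p, hp, h⟩; exact ⟨p, hp, Subtype.ext h⟩
  · rintro ⟨p, hp, h⟩; exact ⟨p, hp, congrArg Subtype.val h⟩

theorem basicOpen_eq {X : Set (G.edgeSet × Set.Ioo (0 : ℝ) 1)} (hX : X.Finite)
    (K : (G.deleteEdges (edgesOf X)).ConnectedComponent) : basicOpen X K = cutOpen X K.supp := by
  ext p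
  cases p with
  | vertex v => rfl
  | inner e t => rfl
  | edgeEnd ω => exact livesIn_iff (finite_edgesOf hX) K

/-- Every edge leaving `A` carries a point of `X`, so `A` is a union of components of the graph
minus the edges that meet `X`, and the set is the union of the corresponding generators. -/
theorem isOpen_cutOpen {X : Set (G.edgeSet × Set.Ioo (0 : ℝ) 1)} (hX : X.Finite) {A : Set V}
    (hA : boundary G A ⊆ Prod.fst '' X) : IsOpen (cutOpen X A) := by
  have hF : ∀ e ∈ boundary G A, e.1 ∈ edgesOf X := fun e he => mem_edgesOf.2 (hA he)
  have hfin : (boundary G A).Finite := (hX.image _).subset hA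
  have hmk : ∀ v, v ∈ ((G.deleteEdges (edgesOf X)).connectedComponentMk v).supp := fun v => rfl
  have : cutOpen X A = ⋃ (K : (G.deleteEdges (edgesOf X)).ConnectedComponent) (_ : K.supp ⊆ A),
      basicOpen X K := by
    ext p
    simp only [Set.mem_iUnion]
    constructor
    · intro hp
      cases p with
      | vertex v => exact ⟨_, supp_subset hF (hmk v) hp, hmk v⟩
      | inner e t =>
        rcases hp with ⟨h, h'⟩ | ⟨h, h'⟩
        · exact ⟨_, supp_subset hF (hmk _) h, Or.inl ⟨hmk _, h'⟩⟩
        · exact ⟨_, supp_subset hF (hmk _) h, Or.inr ⟨hmk _, h'⟩⟩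
      | edgeEnd ω =>
        rw [edgeEnd_mem_cutOpen, mem_track_iff_eventually hfin] at hp
        obtain ⟨K, m, hm⟩ :=
          (Quotient.out (s := raySetoid G) ω).exists_hasTailIn (finite_edgesOf hX)
        obtain ⟨n, hn₁, hn₂⟩ := (hp.and (eventually_ge_atTop m)).exists
        refine ⟨K, supp_subset hF (hm n hn₂) hn₁, ?_⟩
        rw [basicOpen_eq hX]
        exact mem_track_of_eventually (eventually_atTop.2 ⟨m, hm⟩)
    · rintro ⟨K, hK, hp⟩
      rw [basicOpen_eq hX] at hp
      cases p with
      | vertex v => exact hK hp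
      | inner e t => exact hp.imp (fun h => ⟨hK h.1, h.2⟩) (fun h => ⟨hK h.1, h.2⟩)
      | edgeEnd ω => exact mem_of_superset (f := (track (Point.edgeEnd ω) : Filter V)) hp hK
  rw [this]
  exact isOpen_iUnion fun K => isOpen_iUnion fun _ =>
    TopologicalSpace.isOpen_generateFrom_of_mem (Or.inr ⟨X, K, hX, rfl⟩)

/-- Vertices and edge-ends. -/
def Point.IsNode : Point G → Prop
  | .inner _ _ => False
  | _ => True

theorem Point.IsNode.mem_cutOpen {p : Point G} (hp : p.IsNode)
    {X : Set (G.edgeSet × Set.Ioo (0 : ℝ) 1)} {A : Set V} : p ∈ cutOpen X A ↔ A ∈ track p := by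
  cases p with
  | vertex v => simp
  | inner e t => exact hp.elim
  | edgeEnd ω => rfl

theorem Point.isNode_vertex (v : V) : (Point.vertex v : Point G).IsNode := trivial

theorem Point.isNode_edgeEnd (ω : EdgeEnd G) : (Point.edgeEnd ω).IsNode := trivial

theorem isOpen_inner_image {e : G.edgeSet} {U : Set (Set.Ioo (0 : ℝ) 1)} (hU : IsOpen U) :
    IsOpen (Point.inner e '' U) :=
  TopologicalSpace.isOpen_generateFrom_of_mem (Or.inl ⟨e, U, hU, rfl⟩)

theorem cutOpen_inter_subset (X Y : Set (G.edgeSet × Set.Ioo (0 : ℝ) 1)) (A B : Set V) :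
    cutOpen (X ∪ Y) (A ∩ B) ⊆ cutOpen X A ∩ cutOpen Y B := by
  intro p hp
  cases p with
  | vertex v => exact hp
  | inner e t =>
    rcases hp with ⟨h, h'⟩ | ⟨h, h'⟩
    · exact ⟨Or.inl ⟨h.1, fun s hs => h' s (Or.inl hs)⟩, Or.inl ⟨h.2, fun s hs => h' s (Or.inr hs)⟩⟩
    · exact ⟨Or.inr ⟨h.1, fun s hs => h' s (Or.inl hs)⟩, Or.inr ⟨h.2, fun s hs => h' s (Or.inr hs)⟩⟩
  | edgeEnd ω =>
    exact Filter.inter_mem_iff (f := (track (Point.edgeEnd ω) : Filter V)).1 hp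

/-- The sets `cutOpen X A` form a neighbourhood basis at every vertex and every edge-end. -/
theorem Point.IsNode.exists_cutOpen_subset {p : Point G} (hp : p.IsNode) {W : Set (Point G)}
    (hW : IsOpen W) (hpW : p ∈ W) :
    ∃ (X : Set (G.edgeSet × Set.Ioo (0 : ℝ) 1)) (A : Set V), X.Finite ∧
      boundary G A ⊆ Prod.fst '' X ∧ A ∈ track p ∧ cutOpen X A ⊆ W := by
  induction hW with
  | basic s hs =>
    rcases hs with ⟨e, U, _, rfl⟩ | ⟨X, K, hX, rfl⟩
    · obtain ⟨t, _, rfl⟩ := hpW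
      exact hp.elim
    · rw [basicOpen_eq hX] at hpW ⊢
      exact ⟨X, _, hX, fun e he => mem_edgesOf.1 (boundary_supp K e he), hp.mem_cutOpen.1 hpW,
        subset_rfl⟩
  | univ =>
    exact ⟨∅, Set.univ, Set.finite_empty, fun e he => (he (by simp)).elim, univ_mem,
      Set.subset_univ _⟩
  | inter s t _ _ ihs iht =>
    obtain ⟨X, A, hX, hA, hpA, hs⟩ := ihs hpW.1
    obtain ⟨Y, B, hY, hB, hpB, ht⟩ := iht hpW.2
    refine ⟨X ∪ Y, A ∩ B, hX.union hY, ?_, inter_mem hpA hpB,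
      (cutOpen_inter_subset X Y A B).trans (Set.inter_subset_inter hs ht)⟩
    rw [Set.image_union]
    exact (boundary_inter_subset A B).trans (Set.union_subset_union hA hB)
  | sUnion S _ ih =>
    obtain ⟨s, hs, hps⟩ := hpW
    obtain ⟨X, A, hX, hA, hpA, h⟩ := ih s hs hps
    exact ⟨X, A, hX, hA, hpA, h.trans (Set.subset_sUnion_of_mem hs)⟩

theorem isOpen_forall_lt {X : Set (G.edgeSet × Set.Ioo (0 : ℝ) 1)} (hX : X.Finite)
    (e : G.edgeSet) : IsOpen {r : ℝ | ∀ s, (e, s) ∈ X → r < s} := by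
  have hfin : {s | (e, s) ∈ X}.Finite := hX.preimage (Prod.mk_right_injective e).injOn
  have : {r : ℝ | ∀ s, (e, s) ∈ X → r < s} = ⋂ s ∈ {s | (e, s) ∈ X}, Set.Iio (s : ℝ) := by
    ext r; simp
  rw [this]
  exact hfin.isOpen_biInter fun s _ => isOpen_Iio

theorem isOpen_forall_gt {X : Set (G.edgeSet × Set.Ioo (0 : ℝ) 1)} (hX : X.Finite)
    (e : G.edgeSet) : IsOpen {r : ℝ | ∀ s, (e, s) ∈ X → (s : ℝ) < r} := by
  have hfin : {s | (e, s) ∈ X}.Finite := hX.preimage (Prod.mk_right_injective e).injOn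
  have : {r : ℝ | ∀ s, (e, s) ∈ X → (s : ℝ) < r} = ⋂ s ∈ {s | (e, s) ∈ X}, Set.Ioi (s : ℝ) := by
    ext r; simp
  rw [this]
  exact hfin.isOpen_biInter fun s _ => isOpen_Ioi

/-! ### Closed edges and continuous real functions -/

/-- The closed edge `e`, run through from `source e` to `target e`. -/
noncomputable def edgePath (e : G.edgeSet) (r : ℝ) : Point G :=
  if h₀ : r ≤ 0 then .vertex (source e) else
    if h₁ : 1 ≤ r then .vertex (target e) else .inner e ⟨r, not_le.1 h₀, not_le.1 h₁⟩

theorem edgePath_coe (e : G.edgeSet) (t : Set.Ioo (0 : ℝ) 1) : edgePath e t = .inner e t := by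
  rw [edgePath, dif_neg (not_le.2 t.2.1), dif_neg (not_le.2 t.2.2)]

theorem edgePath_of_le {e : G.edgeSet} {r : ℝ} (h : r ≤ 0) :
    edgePath e r = .vertex (source e) := dif_pos h

theorem edgePath_of_ge {e : G.edgeSet} {r : ℝ} (h : 1 ≤ r) :
    edgePath e r = .vertex (target e) := by
  rw [edgePath, dif_neg (by linarith), dif_pos h]

theorem mk_edgePath_mem_edgePts (e : G.edgeSet) (r : ℝ) :
    (SeparationQuotient.mk (edgePath e r) : GTilde G) ∈ edgePts e := by
  by_cases h₀ : r ≤ 0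
  · rw [edgePath_of_le h₀]; exact Or.inl (Or.inl rfl)
  by_cases h₁ : 1 ≤ r
  · rw [edgePath_of_ge h₁]; exact Or.inl (Or.inr rfl)
  · have : edgePath e r = .inner e ⟨r, not_le.1 h₀, not_le.1 h₁⟩ := edgePath_coe e ⟨r, not_le.1 h₀, not_le.1 h₁⟩
    rw [this]; exact Or.inr ⟨_, rfl⟩

theorem continuous_edgePath (e : G.edgeSet) : Continuous (edgePath e) := by
  refine continuous_generateFrom_iff.2 ?_
  rintro _ (⟨e', U, hU, rfl⟩ | ⟨X, K, hX, rfl⟩)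
  · by_cases he : e' = e
    · subst he
      have : edgePath e' ⁻¹' (Point.inner e' '' U) = Subtype.val '' U := by
        ext r
        constructor
        · rintro ⟨t, ht, h⟩
          by_cases h₀ : r ≤ 0
          · rw [edgePath_of_le h₀] at h; cases h
          by_cases h₁ : 1 ≤ r
          · rw [edgePath_of_ge h₁] at h; cases h
          · rw [edgePath, dif_neg h₀, dif_neg h₁] at h
            injection h with _ h
            exact ⟨t, ht, congrArg Subtype.val h⟩
        · rintro ⟨t, ht, rfl⟩
          exact ⟨t, ht, (edgePath_coe e' t).symm⟩
      rw [this]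
      exact isOpen_Ioo.isOpenMap_subtype_val U hU
    · have : edgePath e ⁻¹' (Point.inner e' '' U) = ∅ := by
        refine Set.eq_empty_of_forall_notMem ?_
        rintro r ⟨t, ht, h⟩
        by_cases h₀ : r ≤ 0
        · rw [edgePath_of_le h₀] at h; cases h
        by_cases h₁ : 1 ≤ r
        · rw [edgePath_of_ge h₁] at h; cases h
        · rw [edgePath, dif_neg h₀, dif_neg h₁] at h
          injection h with h _
          exact he h
      rw [this]; exact isOpen_empty
  · rw [basicOpen_eq hX]
    have : edgePath e ⁻¹' cutOpen X K.supp =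
        {r : ℝ | source e ∈ K.supp ∧ ∀ s, (e, s) ∈ X → r < s} ∪
        {r : ℝ | target e ∈ K.supp ∧ ∀ s, (e, s) ∈ X → (s : ℝ) < r} := by
      -- At an end of the edge, the clause belonging to the other end can hold only if `X` has no
      -- point on `e`; then both ends lie in `K` or neither does.
      have hb : (∀ s, (e, s) ∉ X) → (source e ∈ K.supp ↔ target e ∈ K.supp) := by
        intro h
        by_contra hc
        obtain ⟨p, hp, hpe⟩ := mem_edgesOf.1 (boundary_supp K e hc)
        exact h p.2 (by rw [← hpe]; exact hp)
      ext r
      simp only [Set.mem_preimage, Set.mem_union, Set.mem_ofPred_eq]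
      by_cases h₀ : r ≤ 0
      · rw [edgePath_of_le h₀, vertex_mem_cutOpen]
        constructor
        · exact fun h => Or.inl ⟨h, fun s _ => h₀.trans_lt s.2.1⟩
        · rintro (h | ⟨h, h'⟩)
          · exact h.1
          · exact (hb fun s hs => absurd (h' s hs) (not_lt.2 (h₀.trans s.2.1.le))).2 h
      by_cases h₁ : 1 ≤ r
      · rw [edgePath_of_ge h₁, vertex_mem_cutOpen]
        constructor
        · exact fun h => Or.inr ⟨h, fun s _ => s.2.2.trans_le h₁⟩
        · rintro (⟨h, h'⟩ | h)
          · exact (hb fun s hs => absurd (h' s hs) (not_lt.2 (s.2.2.le.trans h₁))).1 h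
          · exact h.1
      · rw [edgePath, dif_neg h₀, dif_neg h₁, inner_mem_cutOpen]
        simp only [← Subtype.coe_lt_coe]
    rw [this]
    refine IsOpen.union ?_ ?_
    · by_cases h : source e ∈ K.supp
      · simpa only [h, true_and] using isOpen_forall_lt hX e
      · simp [h]
    · by_cases h : target e ∈ K.supp
      · simpa only [h, true_and] using isOpen_forall_gt hX e
      · simp [h]

theorem continuous_inner (e : G.edgeSet) : Continuous (Point.inner e) := by
  have : Point.inner e = edgePath e ∘ Subtype.val := funext fun t => (edgePath_coe e t).symm
  rw [this]
  exact (continuous_edgePath e).comp continuous_subtype_val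

theorem inner_injective (e : G.edgeSet) : Function.Injective (Point.inner e) := by
  intro s t h; injection h

theorem isOpenEmbedding_inner (e : G.edgeSet) : IsOpenEmbedding (Point.inner e) :=
  .of_continuous_injective_isOpenMap (continuous_inner e) (inner_injective e)
    fun _ => isOpen_inner_image

/-- A real function is continuous if it is continuous on the open edges and every vertex and
edge-end has small neighbourhoods. -/
theorem continuous_of_isNode {f : Point G → ℝ} (h : ∀ e, Continuous fun t => f (.inner e t))
    (h' : ∀ p : Point G, p.IsNode → ∀ ε > 0, ∃ (X : Set (G.edgeSet × Set.Ioo (0 : ℝ) 1))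
      (A : Set V), X.Finite ∧ boundary G A ⊆ Prod.fst '' X ∧ A ∈ track p ∧
      ∀ q ∈ cutOpen X A, |f q - f p| < ε) : Continuous f := by
  rw [continuous_iff_continuousAt]
  intro p
  by_cases hp : p.IsNode
  · rw [Metric.continuousAt_iff']
    intro ε hε
    obtain ⟨X, A, hX, hA, hpA, hf⟩ := h' p hp ε hε
    exact mem_of_superset ((isOpen_cutOpen hX hA).mem_nhds (hp.mem_cutOpen.2 hpA)) hf
  · cases p with
    | inner e t =>
      rw [← (isOpenEmbedding_inner e).continuousAt_iff]
      exact (h e).continuousAt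
    | vertex v => exact (hp trivial).elim
    | edgeEnd ω => exact (hp trivial).elim

open Classical in
/-- The indicator function of the complement of `A`, interpolated linearly on the edges. -/
noncomputable def cutFun (A : Set V) : Point G → ℝ
  | .inner e t => (if source e ∈ A then 0 else 1) * (1 - t) + (if target e ∈ A then 0 else 1) * t
  | p => if A ∈ track p then 0 else 1

open Classical in
theorem Point.IsNode.cutFun {p : Point G} (hp : p.IsNode) (A : Set V) :
    cutFun A p = if A ∈ track p then 0 else 1 := by
  cases p with
  | vertex v => rfl
  | inner e t => exact hp.elim
  | edgeEnd ω => rfl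

open Classical in
theorem cutFun_inner (A : Set V) (e : G.edgeSet) (t : Set.Ioo (0 : ℝ) 1) :
    cutFun A (.inner e t) =
      (if source e ∈ A then 0 else 1) * (1 - t : ℝ) + (if target e ∈ A then 0 else 1) * t := rfl

theorem continuous_cutFun {A : Set V} (hA : (boundary G A).Finite) :
    Continuous (cutFun A : Point G → ℝ) := by
  refine continuous_of_isNode (fun e => ?_) fun p hp ε hε => ?_
  · simp only [cutFun_inner]
    fun_prop
  · obtain ⟨δ, hδ₀, hδ⟩ := exists_between (lt_min hε (one_half_pos (α := ℝ)))
    have hδ₁ : δ < ε := hδ.trans_le (min_le_left _ _)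
    have hδ₂ : δ < 1 / 2 := hδ.trans_le (min_le_right _ _)
    -- Either end of a boundary edge may be the one in `A`, so each such edge is cut close to both
    -- of its ends.
    let X : Set (G.edgeSet × Set.Ioo (0 : ℝ) 1) :=
      boundary G A ×ˢ {⟨δ, hδ₀, by linarith⟩, ⟨1 - δ, by linarith, by linarith⟩}
    have hX : X.Finite := hA.prod (Set.toFinite _)
    have hAX : boundary G A ⊆ Prod.fst '' X := fun e he => ⟨(e, _), ⟨he, Or.inl rfl⟩, rfl⟩
    have key : ∀ q ∈ cutOpen X A, |cutFun A q| < ε := by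
      intro q hq
      cases q with
      | vertex v => rw [(Point.isNode_vertex v).cutFun, if_pos (by simpa using hq)]; simpa
      | edgeEnd ω => rw [Point.IsNode.cutFun (by trivial), if_pos (edgeEnd_mem_cutOpen.1 hq)]; simpa
      | inner e t =>
        rw [cutFun_inner]
        by_cases he : e ∈ boundary G A
        · rcases hq with ⟨h, h'⟩ | ⟨h, h'⟩
          · have : (t : ℝ) < δ := h' _ ⟨he, Or.inl rfl⟩
            have h2 : target e ∉ A := fun h2 => he ⟨fun _ => h2, fun _ => h⟩
            rw [if_pos h, if_neg h2, zero_mul, zero_add, one_mul, abs_of_pos t.2.1]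
            linarith
          · have : 1 - δ < (t : ℝ) := h' _ ⟨he, Or.inr rfl⟩
            have h2 : source e ∉ A := fun h2 => he ⟨fun _ => h, fun _ => h2⟩
            have := t.2.2
            rw [if_pos h, if_neg h2, zero_mul, add_zero, one_mul, abs_of_pos (by linarith)]
            linarith
        · rw [mem_boundary, not_not] at he
          have hs : source e ∈ A := by rcases hq with h | h; exacts [h.1, he.2 h.1]
          rw [if_pos hs, if_pos (he.1 hs)]; simpa
    have key' : ∀ q ∈ cutOpen X Aᶜ, |cutFun A q - 1| < ε := by
      intro q hq
      cases q with
      | vertex v =>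
        rw [(Point.isNode_vertex v).cutFun, if_neg (by simpa using hq)]; simpa
      | edgeEnd ω =>
        rw [Point.IsNode.cutFun (by trivial), if_neg (Ultrafilter.compl_mem_iff_notMem.1 (edgeEnd_mem_cutOpen.1 hq))]
        simpa
      | inner e t =>
        rw [cutFun_inner]
        by_cases he : e ∈ boundary G A
        · rcases hq with ⟨h, h'⟩ | ⟨h, h'⟩
          · have : (t : ℝ) < δ := h' _ ⟨he, Or.inl rfl⟩
            have h2 : target e ∈ A := by
              by_contra h2; exact he ⟨fun h3 => (h h3).elim, fun h3 => (h2 h3).elim⟩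
            have := t.2.1
            rw [if_neg h, if_pos h2, abs_lt]
            constructor <;> linarith
          · have : 1 - δ < (t : ℝ) := h' _ ⟨he, Or.inr rfl⟩
            have h2 : source e ∈ A := by
              by_contra h2; exact he ⟨fun h3 => (h2 h3).elim, fun h3 => (h h3).elim⟩
            have := t.2.2
            rw [if_neg h, if_pos h2, abs_lt]
            constructor <;> linarith
        · rw [mem_boundary, not_not] at he
          have hs : source e ∉ A := by
            rcases hq with h | h
            exacts [h.1, fun h2 => h.1 (he.1 h2)]
          rw [if_neg hs, if_neg (fun h2 => hs (he.2 h2))]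
          simpa
    by_cases hpA : A ∈ track p
    · refine ⟨X, A, hX, hAX, hpA, fun q hq => ?_⟩
      rw [hp.cutFun, if_pos hpA, sub_zero]
      exact key q hq
    · refine ⟨X, Aᶜ, hX, by rwa [boundary_compl], Ultrafilter.compl_mem_iff_notMem.2 hpA,
        fun q hq => ?_⟩
      rw [hp.cutFun, if_neg hpA]
      exact key' q hq

/-! ### Rays from nested cuts, and compactness -/

/-- A walk to a fixed vertex `v₀` stays in its component until it uses an edge of `F`, so every
component contains `v₀` or an end of a pair in `F`. -/
theorem finite_connectedComponent_deleteEdges (hG : G.Connected) {F : Set (Sym2 V)}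
    (hF : F.Finite) : Finite (G.deleteEdges F).ConnectedComponent := by
  obtain ⟨v₀⟩ := hG.nonempty
  let E : Set V := insert v₀ {v | ∃ f ∈ F, v ∈ f}
  have hE : E.Finite := by
    refine Set.Finite.insert _ (Set.Finite.subset (s := ⋃ f ∈ F, {v | v ∈ f})
      (hF.biUnion fun f _ => ?_) ?_)
    · induction f with
      | _ a b => exact (Set.toFinite {a, b}).subset fun v hv => by simpa using hv
    · rintro v ⟨f, hf, hv⟩
      exact Set.mem_biUnion hf hv
  have key : ∀ w, ∃ z ∈ E, (G.deleteEdges F).Reachable w z := by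
    intro w
    obtain ⟨p⟩ := hG.preconnected w v₀
    suffices ∀ {a b : V} (p : G.Walk a b), b ∈ E → ∃ z ∈ E, (G.deleteEdges F).Reachable a z from
      this p (Set.mem_insert _ _)
    intro a b p hb
    induction p with
    | nil => exact ⟨_, hb, .rfl⟩
    | @cons a c b h p ih =>
      by_cases hf : s(a, c) ∈ F
      · exact ⟨a, Or.inr ⟨_, hf, Sym2.mem_mk_left _ _⟩, .rfl⟩
      · obtain ⟨z, hz, hr⟩ := ih hb
        exact ⟨z, hz, (SimpleGraph.Adj.reachable
          (SimpleGraph.deleteEdges_adj.2 ⟨h, hf⟩)).trans hr⟩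
  have := hE.to_subtype
  refine Finite.of_surjective
    (fun z : E => (G.deleteEdges F).connectedComponentMk z.1) fun K => ?_
  induction K using SimpleGraph.ConnectedComponent.ind with
  | _ w =>
    obtain ⟨z, hz, h⟩ := key w
    exact ⟨⟨z, hz⟩, (SimpleGraph.ConnectedComponent.eq.2 h).symm⟩

theorem exists_supp_mem (hG : G.Connected) (𝒰 : Ultrafilter V) {F : Set (Sym2 V)}
    (hF : F.Finite) : ∃ K : (G.deleteEdges F).ConnectedComponent, K.supp ∈ 𝒰 := by
  have := finite_connectedComponent_deleteEdges hG hF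
  have h : (⋃ K : (G.deleteEdges F).ConnectedComponent, K.supp) = Set.univ :=
    Set.eq_univ_of_forall fun v => Set.mem_iUnion.2 ⟨(G.deleteEdges F).connectedComponentMk v, rfl⟩
  have h' : (⋃ K ∈ (Set.univ : Set (G.deleteEdges F).ConnectedComponent), K.supp) ∈ 𝒰 := by
    rw [Set.biUnion_univ, h]; exact univ_mem
  rw [Ultrafilter.finite_biUnion_mem_iff Set.finite_univ] at h'
  obtain ⟨K, _, hK⟩ := h'
  exact ⟨K, hK⟩

/-- Any two vertices of `K` are joined by a walk of `G` in `K`. -/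
def WalkConnected (G : SimpleGraph V) (K : Set V) : Prop :=
  ∀ u ∈ K, ∀ v ∈ K, ∃ p : G.Walk u v, ∀ w ∈ p.support, w ∈ K

theorem walkConnected_supp {F : Set (Sym2 V)} (K : (G.deleteEdges F).ConnectedComponent) :
    WalkConnected G K.supp := by
  classical
  intro u hu v hv
  rw [SimpleGraph.ConnectedComponent.mem_supp_iff] at hu hv
  obtain ⟨p⟩ := SimpleGraph.ConnectedComponent.exact (hu.trans hv.symm)
  refine ⟨p.mapLe (SimpleGraph.deleteEdges_le F), fun w hw => ?_⟩
  rw [SimpleGraph.Walk.support_mapLe_eq_support] at hw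
  rw [SimpleGraph.ConnectedComponent.mem_supp_iff, ← hu, SimpleGraph.ConnectedComponent.eq]
  exact ⟨(p.takeUntil w hw).reverse⟩

theorem WalkConnected.subset_or {K A : Set V} (hK : WalkConnected G K)
    (h : ∀ e ∈ boundary G A, source e ∉ K ∧ target e ∉ K) : K ⊆ A ∨ K ⊆ Aᶜ := by
  by_cases hne : ∃ u ∈ K, u ∈ A
  · left
    obtain ⟨u, hu, huA⟩ := hne
    intro v hv
    obtain ⟨p, hp⟩ := hK u hu v hv
    induction p with
    | nil => exact huA
    | @cons a b c hab p ih =>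
      have hb : b ∈ K := hp _ (by simp)
      refine ih hb ?_ hv fun w hw => hp w (by simp [hw])
      by_contra hbA
      have he := (mk_mem_boundary hab).2 fun h => hbA (h.1 huA)
      have h1 := h _ he
      rcases Sym2.eq_iff.1 (mk_source_target (⟨s(a, b), hab⟩ : G.edgeSet)) with ⟨h₁, _⟩ | ⟨h₁, _⟩
      · exact h1.1 (by rwa [h₁])
      · exact h1.1 (by rwa [h₁])
  · right
    push Not at hne
    exact hne

/-- If an ultrafilter contains, for every vertex, a side of a finite cut that misses the vertex,
then inside each of its sides of finite cuts it contains a connected one that misses a given finite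
set. -/
theorem exists_connected_cut_subset (hG : G.Connected) {𝒰 : Ultrafilter V}
    (h𝒰 : ∀ v, ∃ A ∈ 𝒰, (boundary G A).Finite ∧ v ∉ A) {A : Set V} (hA : A ∈ 𝒰)
    (hAf : (boundary G A).Finite) {S : Set V} (hS : S.Finite) :
    ∃ K ∈ 𝒰, (boundary G K).Finite ∧ WalkConnected G K ∧ K ⊆ A ∧ Disjoint K S := by
  have h : ∃ B ∈ 𝒰, (boundary G B).Finite ∧ B ⊆ A ∧ Disjoint B S := by
    induction S, hS using Set.Finite.induction_on with
    | empty => exact ⟨A, hA, hAf, subset_rfl, Set.disjoint_empty _⟩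
    | @insert a S _ _ ih =>
      obtain ⟨B, hB, hBf, hBA, hBS⟩ := ih
      obtain ⟨C, hC, hCf, haC⟩ := h𝒰 a
      refine ⟨B ∩ C, inter_mem hB hC, (hBf.union hCf).subset (boundary_inter_subset B C),
        Set.inter_subset_left.trans hBA, ?_⟩
      exact Set.disjoint_insert_right.2 ⟨fun h => haC h.2, hBS.mono_left Set.inter_subset_left⟩
  obtain ⟨B, hB, hBf, hBA, hBS⟩ := h
  have hF : (Subtype.val '' boundary G B).Finite := hBf.image _
  obtain ⟨K, hK⟩ := exists_supp_mem hG 𝒰 hF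
  obtain ⟨v, hvK, hvB⟩ := 𝒰.nonempty_of_mem (inter_mem hK hB)
  have hKB : K.supp ⊆ B := supp_subset (fun e he => Set.mem_image_of_mem _ he) hvK hvB
  refine ⟨K.supp, hK, ?_, walkConnected_supp K, hKB.trans hBA, hBS.mono_left hKB⟩
  exact Set.Finite.of_finite_image
    (hF.subset (by rintro _ ⟨e, he, rfl⟩; exact boundary_supp K e he)) Subtype.val_injective.injOn

/-- A decreasing sequence of nonempty connected sets of vertices such that every vertex misses
one of them gives a ray with a tail in each of them. -/
theorem exists_ray_of_antitone {K : ℕ → Set V} (hK : Antitone K) (hne : ∀ n, (K n).Nonempty)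
    (hconn : ∀ n, WalkConnected G (K n)) (hout : ∀ v, ∃ n, v ∉ K n) :
    ∃ R : Ray G, ∀ n, ∀ᶠ m in atTop, R.toFun m ∈ K n := by
  classical
  let Q : V → ℕ → ℕ → Prop := fun v n l =>
    ∃ z ∈ K (n + 1), ∃ p : G.Walk v z, (∀ w ∈ p.support, w ∈ K n) ∧ p.length = l
  have hQ : ∀ n, ∀ v ∈ K n, ∃ l, Q v n l := by
    intro n v hv
    obtain ⟨z, hz⟩ := hne (n + 1)
    obtain ⟨p, hp⟩ := hconn n v hv z (hK (Nat.le_succ n) hz)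
    exact ⟨_, z, hz, p, hp, rfl⟩
  -- `n` is the level of `v`, and `l` its distance to the next level
  let P : V → ℕ → ℕ → Prop := fun v n l => v ∈ K n ∧ v ∉ K (n + 1) ∧ IsLeast {l | Q v n l} l
  have hP : ∀ n, ∀ v ∈ K n, v ∉ K (n + 1) → ∃ l, P v n l := fun n v hv hv' =>
    ⟨Nat.find (hQ n v hv), hv, hv', Nat.find_spec (hQ n v hv), fun _ h => Nat.find_min' _ h⟩
  have hlev : ∀ n, ∀ v ∈ K n, ∃ m ≥ n, ∃ l, P v m l := by
    intro n v hv
    have h1 : v ∉ K (Nat.find (hout v)) := Nat.find_spec (hout v)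
    have hlt : n < Nat.find (hout v) := by
      by_contra hle
      exact h1 (hK (not_lt.1 hle) hv)
    obtain ⟨m, hm⟩ : ∃ m, Nat.find (hout v) = m + 1 := ⟨Nat.find (hout v) - 1, by omega⟩
    have hvm : v ∈ K m := not_not.1 (Nat.find_min (hout v) (m := m) (by omega))
    obtain ⟨l, h⟩ := hP m v hvm (hm ▸ h1)
    exact ⟨m, by omega, l, h⟩
  -- The first step of a shortest walk to the next level either raises the level or keeps it and
  -- shortens the distance. As level and distance are determined by the vertex, iterating such steps
  -- never repeats a vertex.
  have hstep : ∀ v n l, P v n l → ∃ v' n' l', G.Adj v v' ∧ P v' n' l' ∧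
      (n < n' ∨ n = n' ∧ l' < l) := by
    rintro v n l ⟨hv, hv', ⟨z, hz, p, hp, hl⟩, _⟩
    cases p with
    | nil => exact (hv' hz).elim
    | @cons _ c _ hvc p =>
      by_cases hc : c ∈ K (n + 1)
      · obtain ⟨m, hm, l', h⟩ := hlev _ c hc
        exact ⟨c, m, l', hvc, h, Or.inl hm⟩
      · obtain ⟨l', h⟩ := hP n c (hp c (by simp)) hc
        have hl' : l' ≤ p.length := h.2.2.2 ⟨z, hz, p, fun w hw => hp w (by simp [hw]), rfl⟩
        rw [SimpleGraph.Walk.length_cons] at hl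
        exact ⟨c, n, l', hvc, h, Or.inr ⟨rfl, by omega⟩⟩
  let T := {q : V × ℕ × ℕ // P q.1 q.2.1 q.2.2}
  have hT : Nonempty T := by
    obtain ⟨v, hv⟩ := hne 0
    obtain ⟨m, _, l, h⟩ := hlev 0 v hv
    exact ⟨⟨(v, m, l), h⟩⟩
  have hnext : ∀ q : T, ∃ q' : T, G.Adj q.1.1 q'.1.1 ∧
      (q.1.2.1 < q'.1.2.1 ∨ q.1.2.1 = q'.1.2.1 ∧ q'.1.2.2 < q.1.2.2) := by
    rintro ⟨⟨v, n, l⟩, h⟩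
    obtain ⟨v', n', l', h₁, h₂, h₃⟩ := hstep v n l h
    exact ⟨⟨(v', n', l'), h₂⟩, h₁, h₃⟩
  choose f hfadj hflt using hnext
  obtain ⟨q₀⟩ := hT
  let q : ℕ → T := fun n => f^[n] q₀
  have hq : ∀ n, q (n + 1) = f (q n) := fun n => Function.iterate_succ_apply' f n q₀
  have hlt : ∀ i k, (q i).1.2.1 < (q (i + k + 1)).1.2.1 ∨
      (q i).1.2.1 = (q (i + k + 1)).1.2.1 ∧ (q (i + k + 1)).1.2.2 + k < (q i).1.2.2 := by
    intro i k
    induction k with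
    | zero => rw [add_zero, add_zero, hq]; exact hflt (q i)
    | succ k ih =>
      have h := hflt (q (i + k + 1))
      rw [← hq] at h
      rw [show i + (k + 1) + 1 = i + k + 1 + 1 by omega]
      omega
  have hmono : ∀ i j, i ≤ j → (q i).1.2.1 ≤ (q j).1.2.1 := by
    intro i j hij
    rcases hij.eq_or_lt with rfl | hij
    · rfl
    · obtain ⟨k, rfl⟩ : ∃ k, j = i + k + 1 := ⟨j - i - 1, by omega⟩
      have := hlt i k
      omega
  have huniq : ∀ i j, (q i).1.1 = (q j).1.1 →
      (q i).1.2.1 = (q j).1.2.1 ∧ (q i).1.2.2 = (q j).1.2.2 := by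
    intro i j h
    obtain ⟨hi₁, hi₂, hi₃⟩ := (q i).2
    obtain ⟨hj₁, hj₂, hj₃⟩ := (q j).2
    rw [h] at hi₁ hi₂ hi₃
    have hn : (q i).1.2.1 = (q j).1.2.1 := by
      by_contra hne
      rcases Nat.lt_or_gt_of_ne hne with hlt | hlt
      · exact hi₂ (hK hlt hj₁)
      · exact hj₂ (hK hlt hi₁)
    rw [hn] at hi₃
    exact ⟨hn, hi₃.unique hj₃⟩
  have hne' : ∀ i k, (q i).1.1 ≠ (q (i + k + 1)).1.1 := by
    intro i k h
    have h₁ := huniq _ _ h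
    have h₂ := hlt i k
    omega
  have hunb : ∀ n, ∃ i, n ≤ (q i).1.2.1 := by
    intro n
    induction n with
    | zero => exact ⟨0, Nat.zero_le _⟩
    | succ n ih =>
      obtain ⟨i, hi⟩ := ih
      -- The distance cannot drop more often than its initial value allows, so within that many
      -- steps plus one the level rises.
      have := hlt i ((q i).1.2.2)
      exact ⟨i + (q i).1.2.2 + 1, by omega⟩
  refine ⟨⟨fun i => (q i).1.1, fun i j h => ?_, fun i => ?_⟩, fun n => ?_⟩
  · rcases lt_trichotomy i j with hij | hij | hij
    · obtain ⟨k, rfl⟩ : ∃ k, j = i + k + 1 := ⟨j - i - 1, by omega⟩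
      exact (hne' i k h).elim
    · exact hij
    · obtain ⟨k, rfl⟩ : ∃ k, i = j + k + 1 := ⟨i - j - 1, by omega⟩
      exact (hne' j k h.symm).elim
  · rw [hq]
    exact hfadj (q i)
  · obtain ⟨i, hi⟩ := hunb n
    exact eventually_atTop.2 ⟨i, fun j hj => hK (hi.trans (hmono i j hj)) (q j).2.1⟩

/-- Every ultrafilter on the vertices lies on the same sides of the finite cuts as some vertex or
some edge-end. -/
theorem exists_isNode_track (hG : G.Connected) (𝒰 : Ultrafilter V) :
    ∃ p : Point G, p.IsNode ∧
      ∀ A : Set V, (boundary G A).Finite → (A ∈ track p ↔ A ∈ 𝒰) := by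
  suffices ∃ p : Point G, p.IsNode ∧ ∀ A : Set V, (boundary G A).Finite → A ∈ 𝒰 → A ∈ track p by
    obtain ⟨p, hp, h⟩ := this
    refine ⟨p, hp, fun A hA => ⟨fun hpA => ?_, h A hA⟩⟩
    by_contra hc
    exact Ultrafilter.compl_mem_iff_notMem.1
      (h Aᶜ (by rwa [boundary_compl]) (Ultrafilter.compl_mem_iff_notMem.2 hc)) hpA
  by_cases h𝒰 : ∀ v, ∃ A ∈ 𝒰, (boundary G A).Finite ∧ v ∉ A
  swap
  · push Not at h𝒰
    obtain ⟨v, hv⟩ := h𝒰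
    exact ⟨.vertex v, trivial, fun A hA h => mem_track_vertex.2 (hv A h hA)⟩
  obtain ⟨v₀⟩ := hG.nonempty
  let T := {K : Set V // K ∈ 𝒰 ∧ (boundary G K).Finite ∧ WalkConnected G K}
  -- Avoiding the ends of the boundary edges of `K` keeps all neighbours of `K'` inside `K`.
  have hnext : ∀ K : T, ∃ K' : T, K'.1 ⊆ K.1 ∧
      Disjoint K'.1 (source '' boundary G K.1 ∪ target '' boundary G K.1) := by
    rintro ⟨K, hK, hKf, hKc⟩
    obtain ⟨K', h₁, h₂, h₃, h₄, h₅⟩ := exists_connected_cut_subset hG h𝒰 hK hKf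
      ((hKf.image source).union (hKf.image target))
    exact ⟨⟨K', h₁, h₂, h₃⟩, h₄, h₅⟩
  choose f hfsub hfdisj using hnext
  obtain ⟨K₀, h₁, h₂, h₃, _, h₅⟩ := exists_connected_cut_subset hG h𝒰 univ_mem
    (by simp [boundary]) (Set.finite_singleton v₀)
  let K : ℕ → T := fun n => f^[n] ⟨K₀, h₁, h₂, h₃⟩
  have hKs : ∀ n, K (n + 1) = f (K n) := fun n => Function.iterate_succ_apply' f n _
  have hanti : Antitone fun n => (K n).1 := antitone_nat_of_succ_le fun n => by
    change (K (n + 1)).1 ⊆ (K n).1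
    rw [hKs]; exact hfsub _
  have hnbr : ∀ n u w, G.Adj u w → u ∈ (K (n + 1)).1 → w ∈ (K n).1 := by
    intro n u w huw hu
    by_contra hw
    have huK : u ∈ (K n).1 := hanti (Nat.le_succ n) hu
    have he := (mk_mem_boundary huw).2 fun h => hw (h.1 huK)
    rw [hKs] at hu
    refine Set.disjoint_left.1 (hfdisj (K n)) hu ?_
    rcases Sym2.eq_iff.1 (mk_source_target (⟨s(u, w), huw⟩ : G.edgeSet)) with ⟨h, _⟩ | ⟨_, h⟩
    · exact Or.inl ⟨_, he, h⟩
    · exact Or.inr ⟨_, he, h⟩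
  -- Each edge of a walk loses at most one level. Since `v₀` is outside the first set, a vertex at
  -- the end of a walk of length `l` from `v₀` is outside the set with index `l`.
  have hdist : ∀ {u w : V} (p : G.Walk u w) (n : ℕ), u ∈ (K (n + p.length)).1 → w ∈ (K n).1 := by
    intro u w p
    induction p with
    | nil => exact fun n h => h
    | @cons a b c hab p ih =>
      intro n h
      exact ih n (hnbr _ a b hab h)
  have hout : ∀ v, ∃ n, v ∉ (K n).1 := by
    intro v
    obtain ⟨p⟩ := hG.preconnected v v₀
    refine ⟨0 + p.length, fun h => ?_⟩
    exact Set.disjoint_left.1 h₅ (hdist p 0 h) rfl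
  obtain ⟨R, hR⟩ := exists_ray_of_antitone hanti (fun n => 𝒰.nonempty_of_mem (K n).2.1)
    (fun n => (K n).2.2.2) hout
  refine ⟨.edgeEnd (Quotient.mk (raySetoid G) R), trivial, fun A hA hA𝒰 => ?_⟩
  have hout' : ∀ S : Set V, S.Finite → ∃ n, Disjoint (K n).1 S := by
    intro S hS
    induction S, hS using Set.Finite.induction_on with
    | empty => exact ⟨0, Set.disjoint_empty _⟩
    | @insert a S _ _ ih =>
      obtain ⟨n, hn⟩ := ih
      obtain ⟨m, hm⟩ := hout a
      exact ⟨max n m, Set.disjoint_insert_right.2 ⟨fun h => hm (hanti (le_max_right n m) h),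
        hn.mono_left (hanti (le_max_left n m))⟩⟩
  obtain ⟨n, hn⟩ := hout' _ ((hA.image source).union (hA.image target))
  have hKA : (K n).1 ⊆ A := by
    refine ((K n).2.2.2.subset_or fun e he => ⟨fun h => ?_, fun h => ?_⟩).resolve_right fun h => ?_
    · exact Set.disjoint_left.1 hn h (Or.inl ⟨e, he, rfl⟩)
    · exact Set.disjoint_left.1 hn h (Or.inr ⟨e, he, rfl⟩)
    · obtain ⟨v, hv, hv'⟩ := 𝒰.nonempty_of_mem (inter_mem (K n).2.1 hA𝒰)
      exact h hv hv'
  have hF : (Subtype.val '' boundary G A).Finite := hA.image _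
  obtain ⟨C, hC⟩ := R.exists_hasTailIn hF
  have hCA : C.supp ⊆ A := by
    obtain ⟨m, hm⟩ := hC
    obtain ⟨k, hk₁, hk₂⟩ := ((hR n).and (eventually_ge_atTop m)).exists
    exact supp_subset (fun e he => Set.mem_image_of_mem _ he) (hm k hk₂) (hKA hk₁)
  have hlive : EdgeEnd.LivesIn (Quotient.mk (raySetoid G) R) C := by
    obtain ⟨m, hm⟩ := hC
    exact ⟨_, R.shift_equiv m, fun n => hm _ (by omega)⟩
  exact mem_of_superset (f := (track (Point.edgeEnd (Quotient.mk (raySetoid G) R)) : Filter V))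
    ((livesIn_iff hF C).1 hlive) hCA

theorem compactSpace_point (hG : G.Connected) : CompactSpace (Point G) := by
  refine ⟨isCompact_iff_ultrafilter_le_nhds.2 fun 𝓕 _ => ?_⟩
  by_cases hinner : ∃ e : G.edgeSet, Set.range (Point.inner e) ∈ 𝓕
  · obtain ⟨e, he⟩ := hinner
    have hI : edgePath e '' Set.Icc 0 1 ∈ 𝓕 := by
      refine mem_of_superset he ?_
      rintro _ ⟨t, rfl⟩
      exact ⟨t, ⟨t.2.1.le, t.2.2.le⟩, edgePath_coe e t⟩
    obtain ⟨p, _, hp⟩ := isCompact_iff_ultrafilter_le_nhds.1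
      (isCompact_Icc.image (continuous_edgePath e)) 𝓕 (le_principal_iff.2 hI)
    exact ⟨p, trivial, hp⟩
  push Not at hinner
  -- A set `A` belongs to the bound ultrafilter when `𝓕`-most points have `A` in their track, so the
  -- node found here is the candidate limit of `𝓕`.
  obtain ⟨p, hp, h⟩ := exists_isNode_track hG (Ultrafilter.bind 𝓕 track)
  refine ⟨p, trivial, fun W hW => ?_⟩
  obtain ⟨W', hW'W, hW', hpW'⟩ := mem_nhds_iff.1 hW
  obtain ⟨X, A, hX, hA, hpA, hXA⟩ := hp.exists_cutOpen_subset hW' hpW'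
  have h₁ : {q | A ∈ track q} ∈ 𝓕 := (h A ((hX.image _).subset hA)).1 hpA
  -- Off the finitely many edges that meet `X`, the arbitrary choice of `source e` in the track of
  -- an inner point does no harm.
  have h₂ : (⋂ e ∈ Prod.fst '' X, (Set.range (Point.inner e))ᶜ) ∈ 𝓕 :=
    (biInter_mem (hX.image _)).2 fun e _ => Ultrafilter.compl_mem_iff_notMem.2 (hinner e)
  refine mem_of_superset (inter_mem h₁ h₂) fun q hq => hW'W (hXA ?_)
  obtain ⟨hq₁, hq₂⟩ := hq
  cases q with
  | vertex v => exact mem_track_vertex (G := G).1 hq₁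
  | edgeEnd ω => exact hq₁
  | inner e t =>
    refine Or.inl ⟨mem_track_inner.1 hq₁, fun s hs => ?_⟩
    exact (Set.mem_iInter₂.1 hq₂ e ⟨_, hs, rfl⟩ ⟨t, rfl⟩).elim

/-! ### Joining arcs in a Hausdorff space -/

section Arcs

variable {Y : Type*} [TopologicalSpace Y]

/-- `x` and `y` are equal or joined by an arc in `H`. -/
def ArcJoined (H : Set Y) (x y : Y) : Prop :=
  ∃ (f : ℝ → Y) (a b : ℝ), a ≤ b ∧ ContinuousOn f (Set.Icc a b) ∧ Set.InjOn f (Set.Icc a b) ∧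
    f a = x ∧ f b = y ∧ Set.MapsTo f (Set.Icc a b) H

theorem ArcJoined.symm {H : Set Y} {x y : Y} (h : ArcJoined H x y) : ArcJoined H y x := by
  obtain ⟨f, a, b, hab, hc, hi, ha, hb, hH⟩ := h
  have hm : Set.MapsTo (fun r : ℝ => -r) (Set.Icc (-b) (-a)) (Set.Icc a b) := fun r hr =>
    ⟨by linarith [hr.2], by linarith [hr.1]⟩
  refine ⟨fun r => f (-r), -b, -a, by linarith, hc.comp continuous_neg.continuousOn hm,
    fun r hr s hs h => neg_injective (hi (hm hr) (hm hs) h), by simpa, by simpa, fun r hr =>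
      hH (hm hr)⟩

theorem ArcJoined.trans [T2Space Y] {H : Set Y} {x y z : Y} (h₁ : ArcJoined H x y)
    (h₂ : ArcJoined H y z) : ArcJoined H x z := by
  obtain ⟨f, a, b, hab, hfc, hfi, hfa, hfb, hfH⟩ := h₁
  obtain ⟨g, c, d, hcd, hgc, hgi, hgc', hgd, hgH⟩ := h₂
  -- Switching to `g` at the first parameter where `f` meets the second arc keeps the concatenation
  -- injective.
  have hS : IsCompact (Set.Icc a b ∩ f ⁻¹' (g '' Set.Icc c d)) :=
    isCompact_Icc.of_isClosed_subset
      (hfc.preimage_isClosed_of_isClosed isClosed_Icc (isCompact_Icc.image_of_continuousOn hgc).isClosed)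
      Set.inter_subset_left
  obtain ⟨t₀, ⟨ht₀, s₀, hs₀, hst⟩, hmin⟩ := hS.exists_isLeast
    ⟨b, ⟨hab, le_rfl⟩, c, ⟨le_rfl, hcd⟩, by rw [hgc', hfb]⟩
  have hm : Set.MapsTo (fun r => r - t₀ + s₀) (Set.Icc t₀ (t₀ + d - s₀)) (Set.Icc c d) :=
    fun r hr => ⟨by linarith [hr.1, hs₀.1], by linarith [hr.2]⟩
  have hmf : Set.Icc a t₀ ⊆ Set.Icc a b := Set.Icc_subset_Icc_right ht₀.2
  refine ⟨fun r => if r ≤ t₀ then f r else g (r - t₀ + s₀), a, t₀ + d - s₀,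
    by linarith [ht₀.1, hs₀.2], ?_, ?_, ?_, ?_, ?_⟩
  · have hU : Set.Icc a (t₀ + d - s₀) = Set.Icc a t₀ ∪ Set.Icc t₀ (t₀ + d - s₀) :=
      (Set.Icc_union_Icc_eq_Icc ht₀.1 (by linarith [hs₀.2])).symm
    rw [hU]
    refine ContinuousOn.union_of_isClosed ?_ ?_ isClosed_Icc isClosed_Icc
    · exact (hfc.mono hmf).congr fun r hr => if_pos hr.2
    · refine (hgc.comp (f := fun r => r - t₀ + s₀) (by fun_prop) hm).congr fun r hr => ?_
      rcases hr.1.eq_or_lt with rfl | h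
      · simp [hst]
      · simp [not_le.2 h]
  · have key : ∀ r ∈ Set.Icc a t₀, ∀ s ∈ Set.Icc t₀ (t₀ + d - s₀), f r = g (s - t₀ + s₀) →
        r = s := by
      intro r hr s hs h
      have hrt : r = t₀ := le_antisymm hr.2 (hmin ⟨hmf hr, _, hm hs, h.symm⟩)
      subst hrt
      rw [← hst] at h
      have := hgi hs₀ (hm hs) h
      linarith
    intro r hr s hs h
    by_cases hr' : r ≤ t₀ <;> by_cases hs' : s ≤ t₀ <;> simp only [hr', hs', if_true, if_false] at h
    · exact hfi (hmf ⟨hr.1, hr'⟩) (hmf ⟨hs.1, hs'⟩) h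
    · exact key r ⟨hr.1, hr'⟩ s ⟨(not_le.1 hs').le, hs.2⟩ h
    · exact (key s ⟨hs.1, hs'⟩ r ⟨(not_le.1 hr').le, hr.2⟩ h.symm).symm
    · have := hgi (hm ⟨(not_le.1 hr').le, hr.2⟩) (hm ⟨(not_le.1 hs').le, hs.2⟩) h
      linarith
  · simp [ht₀.1, hfa]
  · by_cases h : t₀ + d - s₀ ≤ t₀
    · have hd : s₀ = d := le_antisymm hs₀.2 (by linarith)
      subst hd
      simp [← hst, hgd]
    · simp only [h, if_false]
      rw [show t₀ + d - s₀ - t₀ + s₀ = d by ring, hgd]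
  · intro r hr
    by_cases h : r ≤ t₀
    · simp only [h, if_true]; exact hfH (hmf ⟨hr.1, h⟩)
    · simp only [h, if_false]; exact hgH (hm ⟨(not_le.1 h).le, hr.2⟩)

theorem isArcConnected_of_arcJoined [T2Space Y] {H : Set Y}
    (h : ∀ x ∈ H, ∀ y ∈ H, ArcJoined H x y) : IsArcConnected H := by
  intro x hx y hy hxy
  obtain ⟨f, a, b, hab, hc, hi, ha, hb, hH⟩ := h x hx y hy
  have hlt : a < b := hab.lt_of_ne fun h => hxy (by rw [← ha, ← hb, h])
  have hm : ∀ r : unitInterval, a + (b - a) * r ∈ Set.Icc a b := fun r =>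
    ⟨by nlinarith [r.2.1], by nlinarith [r.2.2]⟩
  refine ⟨fun r => f (a + (b - a) * r), ?_, by simpa, by simpa, ?_⟩
  · refine (Continuous.isClosedEmbedding ?_ ?_).isEmbedding
    · exact hc.comp_continuous (by fun_prop) hm
    · intro r s hrs
      have := hi (hm r) (hm s) hrs
      have hne : b - a ≠ 0 := by linarith
      exact Subtype.ext (mul_left_cancel₀ hne (by linarith))
  · rintro _ ⟨r, rfl⟩
    exact hH (hm r)

end Arcs

/-! ### Separating points by continuous functions -/

theorem exists_cut_of_not_inseparable {p q : Point G} (hp : p.IsNode) (hq : q.IsNode)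
    (h : ¬Inseparable p q) :
    ∃ A : Set V, (boundary G A).Finite ∧ A ∈ track p ∧ A ∉ track q := by
  rw [inseparable_iff_forall_isOpen] at h
  push Not at h
  obtain ⟨W, hW, ⟨h₁, h₂⟩ | ⟨h₁, h₂⟩⟩ := h
  · obtain ⟨X, A, hX, hA, hpA, hXA⟩ := hp.exists_cutOpen_subset hW h₁
    exact ⟨A, (hX.image _).subset hA, hpA, fun h => h₂ (hXA (hq.mem_cutOpen.2 h))⟩
  · obtain ⟨X, A, hX, hA, hqA, hXA⟩ := hq.exists_cutOpen_subset hW h₂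
    refine ⟨Aᶜ, by rw [boundary_compl]; exact (hX.image _).subset hA, ?_, ?_⟩
    · exact Ultrafilter.compl_mem_iff_notMem.2 fun h => h₁ (hXA (hp.mem_cutOpen.2 h))
    · exact fun h => Ultrafilter.compl_mem_iff_notMem.1 h hqA

open Classical in
/-- A bump function on the edge `e` around its point `t`. -/
noncomputable def bump (e : G.edgeSet) (t : Set.Ioo (0 : ℝ) 1) : Point G → ℝ
  | .inner e' s => if e' = e then max 0 (min (t : ℝ) (1 - t) / 2 - |(s : ℝ) - t|) else 0
  | _ => 0

theorem Point.IsNode.bump {p : Point G} (hp : p.IsNode) (e : G.edgeSet) (t : Set.Ioo (0 : ℝ) 1) :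
    bump e t p = 0 := by
  cases p with
  | vertex v => rfl
  | inner e t => exact hp.elim
  | edgeEnd ω => rfl

theorem continuous_bump (e : G.edgeSet) (t : Set.Ioo (0 : ℝ) 1) : Continuous (bump e t) := by
  classical
  obtain ⟨δ, hδ⟩ : ∃ δ, δ = min (t : ℝ) (1 - t) / 2 := ⟨_, rfl⟩
  have h₁ := min_le_left (t : ℝ) (1 - t)
  have h₂ := min_le_right (t : ℝ) (1 - t)
  have h₀ : 0 < min (t : ℝ) (1 - t) := lt_min t.2.1 (by linarith [t.2.2])
  refine continuous_of_isNode (fun e' => ?_) fun p hp ε hε => ?_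
  · by_cases he : e' = e
    · simp only [bump, he, if_true]; fun_prop
    · simp only [bump, he, if_false]; fun_prop
  -- The points `t - δ` and `t + δ` bound the support of the bump, so with no vertex excluded the
  -- neighbourhood still misses that support.
  · refine ⟨{(e, ⟨t - δ, by linarith, by linarith [t.2.2]⟩),
      (e, ⟨t + δ, by linarith [t.2.1], by linarith⟩)}, Set.univ, Set.toFinite _,
      by simp [boundary], univ_mem, fun q hq => ?_⟩
    rw [hp.bump, sub_zero]
    suffices bump e t q = 0 by rwa [this, abs_zero]
    cases q with
    | vertex v => rfl
    | edgeEnd ω => rfl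
    | inner e' s =>
      simp only [bump]
      split_ifs with he
      · subst he
        refine max_eq_left ?_
        rw [← hδ, sub_nonpos]
        rcases hq with ⟨_, h⟩ | ⟨_, h⟩
        · have : (s : ℝ) < t - δ := h _ (Or.inl rfl)
          rw [abs_sub_comm]
          exact le_trans (by linarith) (le_abs_self _)
        · have : (t : ℝ) + δ < s := h _ (Or.inr rfl)
          exact le_trans (by linarith) (le_abs_self _)
      · rfl

theorem bump_self_ne {e : G.edgeSet} {t : Set.Ioo (0 : ℝ) 1} {q : Point G}
    (hq : q ≠ .inner e t) : bump e t (.inner e t) ≠ bump e t q := by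
  have h₀ : 0 < min (t : ℝ) (1 - t) := lt_min t.2.1 (by linarith [t.2.2])
  have h₁ : bump e t (.inner e t) = min (t : ℝ) (1 - t) / 2 := by
    simp only [bump, if_true, sub_self, abs_zero, sub_zero]
    exact max_eq_right (by linarith)
  have h₂ : bump e t q < min (t : ℝ) (1 - t) / 2 := by
    cases q with
    | vertex v => simp only [bump]; linarith
    | edgeEnd ω => simp only [bump]; linarith
    | inner e' s =>
      simp only [bump]
      split_ifs with he
      · subst he
        refine max_lt (by linarith) ?_
        have : (s : ℝ) - t ≠ 0 := fun h => hq (by rw [Subtype.ext (sub_eq_zero.1 h)])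
        linarith [abs_pos.2 this]
      · linarith
  rw [h₁]
  exact h₂.ne'

theorem exists_continuous_ne {p q : Point G} (h : ¬Inseparable p q) :
    ∃ f : Point G → ℝ, Continuous f ∧ f p ≠ f q := by
  by_cases hp : p.IsNode
  · by_cases hq : q.IsNode
    · obtain ⟨A, hA, h₁, h₂⟩ := exists_cut_of_not_inseparable hp hq h
      exact ⟨_, continuous_cutFun hA, by rw [hp.cutFun, hq.cutFun, if_pos h₁, if_neg h₂]; simp⟩
    · cases q with
      | inner e t =>
        exact ⟨_, continuous_bump e t, (bump_self_ne fun h' => h (by rw [h'])).symm⟩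
      | vertex v => exact (hq trivial).elim
      | edgeEnd ω => exact (hq trivial).elim
  · cases p with
    | inner e t =>
      exact ⟨_, continuous_bump e t, bump_self_ne fun h' => h (by rw [h'])⟩
    | vertex v => exact (hp trivial).elim
    | edgeEnd ω => exact (hp trivial).elim

theorem apply_eq_of_inseparable {f : Point G → ℝ} (hf : Continuous f) {p q : Point G}
    (h : Inseparable p q) : f p = f q := (h.map hf).eq

theorem eq_of_inseparable_inner {e : G.edgeSet} {t : Set.Ioo (0 : ℝ) 1} {q : Point G}
    (h : Inseparable q (.inner e t)) : q = .inner e t := by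
  by_contra hq
  exact bump_self_ne hq (apply_eq_of_inseparable (continuous_bump e t) h).symm

instance t2Space_gTilde : T2Space (GTilde G) := by
  refine ⟨fun x y hne => ?_⟩
  obtain ⟨p, rfl⟩ := SeparationQuotient.surjective_mk x
  obtain ⟨q, rfl⟩ := SeparationQuotient.surjective_mk y
  obtain ⟨f, hf, hfne⟩ := exists_continuous_ne fun h => hne (SeparationQuotient.mk_eq_mk.2 h)
  exact separated_by_continuous
    (f := SeparationQuotient.lift f fun _ _ h => apply_eq_of_inseparable hf h)
    (SeparationQuotient.continuous_lift hf) hfne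

/-- The open sets of the space of points are saturated. -/
theorem mem_of_mk_mem_image {W : Set (Point G)} (hW : IsOpen W) {p : Point G}
    (h : (SeparationQuotient.mk p : GTilde G) ∈ SeparationQuotient.mk '' W) : p ∈ W := by
  obtain ⟨q, hq, hqp⟩ := h
  exact ((SeparationQuotient.mk_eq_mk.1 hqp).mem_open_iff hW).1 hq

theorem arcJoined_inner_source (e : G.edgeSet) (t : Set.Ioo (0 : ℝ) 1) :
    ArcJoined (edgePts e) (SeparationQuotient.mk (.inner e t) : GTilde G) (vertexPt (source e)) := by
  refine ArcJoined.symm ⟨fun r => SeparationQuotient.mk (edgePath e r), 0, t, t.2.1.le,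
    (SeparationQuotient.continuous_mk.comp (continuous_edgePath e)).continuousOn, ?_, ?_, ?_,
    fun r _ => mk_edgePath_mem_edgePts e r⟩
  · have key : ∀ r ∈ Set.Icc (0 : ℝ) t, ∀ s ∈ Set.Icc (0 : ℝ) t,
        (SeparationQuotient.mk (edgePath e r) : GTilde G) = SeparationQuotient.mk (edgePath e s) →
        r ≤ s := by
      intro r hr s hs h
      by_contra hlt
      have hr₀ : 0 < r := hs.1.trans_lt (not_le.1 hlt)
      have hr₁ : r < 1 := hr.2.trans_lt t.2.2
      have h' := SeparationQuotient.mk_eq_mk.1 h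
      have hrr : edgePath e r = .inner e ⟨r, hr₀, hr₁⟩ := edgePath_coe e ⟨r, hr₀, hr₁⟩
      rw [hrr] at h'
      have := eq_of_inseparable_inner h'.symm
      rcases hs.1.eq_or_lt with rfl | hs₀
      · rw [edgePath_of_le le_rfl] at this
        cases this
      · rw [show edgePath e s = .inner e ⟨s, hs₀, hs.2.trans_lt t.2.2⟩ from
          edgePath_coe e ⟨s, hs₀, hs.2.trans_lt t.2.2⟩] at this
        have := congrArg Subtype.val (inner_injective e this)
        exact hlt this.symm.le
    intro r hr s hs h
    exact le_antisymm (key r hr s hs h) (key s hs r hr h.symm)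
  · exact congrArg _ (edgePath_of_le le_rfl)
  · exact congrArg _ (edgePath_coe e t)

theorem ArcJoined.mono {Y : Type*} [TopologicalSpace Y] {H H' : Set Y} {x y : Y}
    (h : ArcJoined H x y) (hH : H ⊆ H') : ArcJoined H' x y := by
  obtain ⟨f, a, b, h₁, h₂, h₃, h₄, h₅, h₆⟩ := h
  exact ⟨f, a, b, h₁, h₂, h₃, h₄, h₅, h₆.mono_right hH⟩

/-- A closed set that contains the open edge `e` contains its ends. -/
theorem edgePts_subset {H : Set (GTilde G)} (hH : IsClosed H) {e : G.edgeSet}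
    (h : ∀ t, (SeparationQuotient.mk (.inner e t) : GTilde G) ∈ H) : edgePts e ⊆ H := by
  have hcont : Continuous fun r => (SeparationQuotient.mk (edgePath e r) : GTilde G) :=
    SeparationQuotient.continuous_mk.comp (continuous_edgePath e)
  have hsub : Set.Icc (0 : ℝ) 1 ⊆ (fun r => SeparationQuotient.mk (edgePath e r)) ⁻¹' H := by
    rw [← closure_Ioo zero_ne_one]
    refine closure_minimal (fun r hr => ?_) (hH.preimage hcont)
    change SeparationQuotient.mk (edgePath e r) ∈ H
    rw [show edgePath e r = .inner e ⟨r, hr⟩ from edgePath_coe e ⟨r, hr⟩]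
    exact h _
  rintro _ ((rfl | rfl) | ⟨t, rfl⟩)
  · have := hsub ⟨le_rfl, zero_le_one⟩
    rwa [Set.mem_preimage, edgePath_of_le le_rfl] at this
  · have := hsub ⟨zero_le_one, le_rfl⟩
    rwa [Set.mem_preimage, edgePath_of_ge le_rfl] at this
  · exact h t

/-! ### Minimal connecting edge sets and their threads -/

/-- Every finite cut that separates `p` from `q` contains an edge of `M`. -/
def Connects (M : Set G.edgeSet) (p q : Point G) : Prop :=
  ∀ A : Set V, (boundary G A).Finite → A ∈ track p → A ∉ track q → ∃ e ∈ M, e ∈ boundary G A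

/-- A member of the chain with the fewest elements in `T` has its trace on `T` contained in every
other member. With `T` a finite cut, this is what makes Zorn's lemma applicable. -/
theorem exists_inter_subset_sInter {α : Type*} {c : Set (Set α)}
    (hc : IsChain (· ⊆ ·) c) (hne : c.Nonempty) {T : Set α} (hT : T.Finite) :
    ∃ s ∈ c, s ∩ T ⊆ ⋂₀ c := by
  obtain ⟨s, hs, hmin⟩ := exists_minimalFor_of_wellFoundedLT (· ∈ c)
    (fun s => (s ∩ T).ncard) hne
  refine ⟨s, hs, fun e he s' hs' => ?_⟩
  rcases hc.total hs hs' with h | h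
  · exact h he.1
  · have h₁ := Set.eq_of_subset_of_ncard_le (Set.inter_subset_inter_left T h)
      (hmin hs' (Set.ncard_le_ncard (Set.inter_subset_inter_left T h) (hT.inter_of_right _)))
      (hT.inter_of_right _)
    rw [← h₁] at he
    exact he.1

theorem Connects.exists_minimal {E : Set G.edgeSet} {p q : Point G} (hE : Connects E p q) :
    ∃ M ⊆ E, Connects M p q ∧ ∀ e ∈ M, ¬Connects (M \ {e}) p q := by
  obtain ⟨M, hME, hM⟩ := zorn_superset_nonempty {M | Connects M p q} (fun c hcS hc hne => by
    refine ⟨⋂₀ c, fun A hA hp hq => ?_, fun s hs => Set.sInter_subset_of_mem hs⟩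
    obtain ⟨s, hs, h⟩ := exists_inter_subset_sInter hc hne hA
    obtain ⟨e, he, heA⟩ := hcS hs A hA hp hq
    exact ⟨e, h ⟨he, heA⟩, heA⟩) E hE
  exact ⟨M, hME, hM.prop, fun e he h => (hM.le_of_le h Set.sdiff_subset he).2 rfl⟩

/-- `M` connects `p` to `q`, and `A e`, for `e ∈ M`, is the side of `p` of a finite cut that
separates `p` from `q` and has `e` as its only edge in `M`. -/
structure IsCutSystem (M : Set G.edgeSet) (A : M → Set V) (p q : Point G) : Prop where
  connects : Connects M p q
  finite : ∀ e, (boundary G (A e)).Finite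
  mem : ∀ e, A e ∈ track p
  notMem : ∀ e, A e ∉ track q
  mem_boundary_iff : ∀ (e f : M), f.1 ∈ boundary G (A e) ↔ f = e

/-- Removing `e` from a minimal `M` leaves some separating finite cut unmet; as `M` itself meets
that cut, it does so exactly in `e`. -/
theorem Connects.exists_isCutSystem {E : Set G.edgeSet} {p q : Point G} (hE : Connects E p q) :
    ∃ M ⊆ E, ∃ A : M → Set V, IsCutSystem M A p q := by
  obtain ⟨M, hME, hM, hmin⟩ := hE.exists_minimal
  have : ∀ e : M, ∃ A : Set V, (boundary G A).Finite ∧ A ∈ track p ∧ A ∉ track q ∧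
      ∀ f : M, f.1 ∈ boundary G A ↔ f = e := by
    intro e
    have h := hmin e e.2
    unfold Connects at h
    push Not at h
    obtain ⟨A, hA, hp, hq, h⟩ := h
    have hne : ∀ f : M, f.1 ∈ boundary G A → f = e := by
      intro f hf
      by_contra hfe
      exact h f ⟨f.2, fun hc => hfe (Subtype.ext hc)⟩ hf
    refine ⟨A, hA, hp, hq, fun f => ⟨hne f, ?_⟩⟩
    rintro rfl
    obtain ⟨g, hgM, hg⟩ := hM A hA hp hq
    rwa [← hne ⟨g, hgM⟩ hg]
  choose A h₁ h₂ h₃ h₄ using this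
  exact ⟨M, hME, A, hM, h₁, h₂, h₃, h₄⟩

theorem mem_diff_iff (𝒰 : Ultrafilter V) {A B : Set V} : A \ B ∈ 𝒰 ↔ A ∈ 𝒰 ∧ B ∉ 𝒰 := by
  rw [Set.sdiff_eq, ← Ultrafilter.compl_mem_iff_notMem]
  exact Filter.inter_mem_iff (f := (𝒰 : Filter V))

theorem mem_inter_iff (𝒰 : Ultrafilter V) {A B : Set V} : A ∩ B ∈ 𝒰 ↔ A ∈ 𝒰 ∧ B ∈ 𝒰 :=
  Filter.inter_mem_iff (f := (𝒰 : Filter V))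

theorem mem_symmDiff_iff (𝒰 : Ultrafilter V) {A B : Set V} :
    symmDiff A B ∈ 𝒰 ↔ ¬(A ∈ 𝒰 ↔ B ∈ 𝒰) := by
  rw [Set.symmDiff_def, Ultrafilter.union_mem_iff, mem_diff_iff, mem_diff_iff]
  tauto

theorem Connects.mem_iff_mem {M : Set G.edgeSet} {p q : Point G} (hM : Connects M p q) {Z : Set V}
    (hZ : (boundary G Z).Finite) (h : ∀ e ∈ M, e ∉ boundary G Z) : Z ∈ track p ↔ Z ∈ track q := by
  constructor
  · intro hp
    by_contra hq
    obtain ⟨e, he, he'⟩ := hM Z hZ hp hq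
    exact h e he he'
  · intro hq
    by_contra hp
    obtain ⟨e, he, he'⟩ := hM Zᶜ (by rwa [boundary_compl])
      (Ultrafilter.compl_mem_iff_notMem.2 hp) fun hc => Ultrafilter.compl_mem_iff_notMem.1 hc hq
    exact h e he (by rwa [boundary_compl] at he')

/-- The points that cannot be cut off by a finite cut that avoids `M` and does not separate `p`
from `q`, together with the open edges in `M`. -/
def thread (M : Set G.edgeSet) (p : Point G) : Set (Point G) :=
  {r | match r with
    | .inner e _ => e ∈ M
    | r => ∀ Z : Set V, (boundary G Z).Finite → (∀ e ∈ M, e ∉ boundary G Z) →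
        (Z ∈ track r ↔ Z ∈ track p)}

theorem inner_mem_thread {M : Set G.edgeSet} {p : Point G} {e : G.edgeSet}
    {t : Set.Ioo (0 : ℝ) 1} : Point.inner e t ∈ thread M p ↔ e ∈ M := Iff.rfl

theorem Point.IsNode.mem_thread {M : Set G.edgeSet} {p r : Point G} (hr : r.IsNode) :
    r ∈ thread M p ↔ ∀ Z : Set V, (boundary G Z).Finite → (∀ e ∈ M, e ∉ boundary G Z) →
      (Z ∈ track r ↔ Z ∈ track p) := by
  cases r with
  | vertex v => rfl
  | inner e t => exact hr.elim
  | edgeEnd ω => rfl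

/-- If a node `r` of the thread were outside `H`, it would have a cut neighbourhood missing `H`. The
edges of `M` have both ends in `H`, so that cut avoids `M`, and `p` lies on the same side as `r`,
hence outside `H`. -/
theorem mk_mem_of_mem_thread {M : Set G.edgeSet} {p : Point G} {H : Set (GTilde G)} (hH : IsClosed H)
    (hpn : p.IsNode) (hp : SeparationQuotient.mk p ∈ H) (hM : ∀ e ∈ M, edgePts e ⊆ H)
    {r : Point G} (hr : r ∈ thread M p) : SeparationQuotient.mk r ∈ H := by
  by_cases hrn : r.IsNode
  · by_contra hrH
    obtain ⟨X, Z, hX, hZX, hZr, hXZ⟩ := hrn.exists_cutOpen_subset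
      (W := (SeparationQuotient.mk ⁻¹' H)ᶜ)
      (hH.preimage SeparationQuotient.continuous_mk).isOpen_compl hrH
    have hout : ∀ v, (vertexPt v : GTilde G) ∈ H → v ∉ Z := fun v hv hvZ =>
      hXZ (vertex_mem_cutOpen.2 hvZ) hv
    have := (hrn.mem_thread.1 hr Z ((hX.image _).subset hZX) fun e he hb => hb
      ⟨fun hc => (hout _ (hM e he (Or.inl (Or.inl rfl))) hc).elim,
        fun hc => (hout _ (hM e he (Or.inl (Or.inr rfl))) hc).elim⟩).1 hZr
    exact hXZ (hpn.mem_cutOpen.2 this) hp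
  · cases r with
    | vertex v => exact (hrn trivial).elim
    | edgeEnd ω => exact (hrn trivial).elim
    | inner e t => exact hM e hr (Or.inr ⟨t, rfl⟩)

namespace IsCutSystem

variable {M : Set G.edgeSet} {A : M → Set V} {p q : Point G}

theorem eq_of_mem_boundary (h : IsCutSystem M A p q) {e : M} {f : G.edgeSet} (hf : f ∈ M)
    (hfe : f ∈ boundary G (A e)) : f = e :=
  congrArg Subtype.val ((h.mem_boundary_iff e ⟨f, hf⟩).1 hfe)

theorem self_mem_boundary (h : IsCutSystem M A p q) (e : M) : e.1 ∈ boundary G (A e) :=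
  (h.mem_boundary_iff e e).2 rfl

theorem source_mem_iff_target_mem (h : IsCutSystem M A p q) {e f : M} (hef : f ≠ e) :
    source f.1 ∈ A e ↔ target f.1 ∈ A e :=
  not_not.1 fun hc => hef ((h.mem_boundary_iff e f).1 hc)

/-- No edge of `M` can lie in a part `Z` that a cut avoiding `M` splits off from `p`: otherwise `A g
\ Z` would still separate `p` from `q`, but its boundary would contain neither `g` nor any other
edge of `M`. -/
theorem source_notMem (h : IsCutSystem M A p q) {Z : Set V} (hZ : (boundary G Z).Finite)
    (hM : ∀ e ∈ M, e ∉ boundary G Z) (hp : Z ∉ track p) (g : M) : source g.1 ∉ Z := by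
  intro hs
  have ht : target g.1 ∈ Z := (not_not.1 (hM g g.2)).1 hs
  obtain ⟨e, he, heb⟩ := h.connects (A g \ Z)
    (((h.finite g).union hZ).subset (boundary_diff_subset _ _))
    ((mem_diff_iff _).2 ⟨h.mem g, hp⟩) fun hc => h.notMem g ((mem_diff_iff _).1 hc).1
  rcases boundary_diff_subset _ _ heb with h' | h'
  · have := h.eq_of_mem_boundary he h'
    subst this
    exact heb ⟨fun h => (h.2 hs).elim, fun h => (h.2 ht).elim⟩
  · exact hM e he h'

theorem source_mem_iff (h : IsCutSystem M A p q) {Z : Set V} (hZ : (boundary G Z).Finite)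
    (hM : ∀ e ∈ M, e ∉ boundary G Z) (g : M) : source g.1 ∈ Z ↔ Z ∈ track p := by
  refine ⟨fun hs => ?_, fun hp => ?_⟩
  · by_contra hp
    exact h.source_notMem hZ hM hp g hs
  · by_contra hs
    exact h.source_notMem (Z := Zᶜ) (by rwa [boundary_compl]) (by rwa [boundary_compl])
      (fun hc => Ultrafilter.compl_mem_iff_notMem.1 hc hp) g hs

theorem source_mem_thread (h : IsCutSystem M A p q) (g : M) :
    Point.vertex (source g.1) ∈ thread M p :=
  (Point.isNode_vertex _).mem_thread.2 fun Z hZ hM => by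
    rw [mem_track_vertex, h.source_mem_iff hZ hM g]

theorem target_mem_thread (h : IsCutSystem M A p q) (g : M) :
    Point.vertex (target g.1) ∈ thread M p :=
  (Point.isNode_vertex _).mem_thread.2 fun Z hZ hM => by
    rw [mem_track_vertex, ← h.source_mem_iff hZ hM g]
    exact (not_not.1 (hM g g.2)).symm

theorem left_mem_thread (hp : p.IsNode) : p ∈ thread M p := hp.mem_thread.2 fun _ _ _ => Iff.rfl

theorem right_mem_thread (h : IsCutSystem M A p q) (hq : q.IsNode) : q ∈ thread M p :=
  hq.mem_thread.2 fun _ hZ hM => (h.connects.mem_iff_mem hZ hM).symm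

/-- Modulo cuts avoiding `M`, every finite cut is a finite symmetric difference of cuts `A e`. If
all `A e` failed to separate two nodes of the thread, no finite cut would separate them. -/
theorem exists_not_iff (h : IsCutSystem M A p q) {r s : Point G} (hr : r.IsNode) (hs : s.IsNode)
    (hrM : r ∈ thread M p) (hsM : s ∈ thread M p) (hrs : ¬Inseparable r s) :
    ∃ e, ¬(A e ∈ track r ↔ A e ∈ track s) := by
  by_contra! hall
  obtain ⟨U, hU, hUr, hUs⟩ := exists_cut_of_not_inseparable hr hs hrs
  suffices ∀ (n : ℕ) (U : Set V), (boundary G U).Finite → (boundary G U ∩ M).ncard = n →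
      (U ∈ track r ↔ U ∈ track s) from hUs ((this _ U hU rfl).1 hUr)
  intro n
  induction n with
  | zero =>
    intro U hU hn
    rw [Set.ncard_eq_zero (hU.inter_of_left _)] at hn
    have hUM : ∀ e ∈ M, e ∉ boundary G U := fun e he he' => by
      have : e ∈ boundary G U ∩ M := ⟨he', he⟩
      rwa [hn] at this
    rw [hr.mem_thread.1 hrM U hU hUM, hs.mem_thread.1 hsM U hU hUM]
  | succ n ih =>
    intro U hU hn
    obtain ⟨e, heU, heM⟩ : (boundary G U ∩ M).Nonempty := by
      rw [← Set.ncard_pos (hU.inter_of_left _), hn]; exact Nat.succ_pos n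
    -- Since `e` is the only edge of `M` in the boundary of `A e`, adding this cut removes exactly
    -- `e` from the trace on `M`.
    have hdiff : boundary G (symmDiff U (A ⟨e, heM⟩)) ∩ M = (boundary G U ∩ M) \ {e} := by
      ext f
      rw [Set.mem_inter_iff, mem_boundary_symmDiff]
      constructor
      · rintro ⟨hf, hfM⟩
        by_cases hfe : f = e
        · subst hfe
          exact (hf ⟨fun _ => h.self_mem_boundary ⟨f, heM⟩, fun _ => heU⟩).elim
        · have : f ∉ boundary G (A ⟨e, heM⟩) := fun hc => hfe (h.eq_of_mem_boundary hfM hc)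
          exact ⟨⟨not_not.1 fun hfU => hf ⟨fun h => (hfU h).elim, fun h => (this h).elim⟩, hfM⟩,
            hfe⟩
      · rintro ⟨⟨hfU, hfM⟩, hfe⟩
        have : f ∉ boundary G (A ⟨e, heM⟩) := fun hc => hfe (h.eq_of_mem_boundary hfM hc)
        exact ⟨fun hc => this (hc.1 hfU), hfM⟩
    have := ih (symmDiff U (A ⟨e, heM⟩))
      ((hU.union (h.finite _)).subset (boundary_symmDiff_subset _ _)) (by
        rw [hdiff, Set.ncard_sdiff_singleton_of_mem (Set.mem_inter heU heM), hn]; rfl)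
    rw [mem_symmDiff_iff, mem_symmDiff_iff, hall ⟨e, heM⟩] at this
    tauto

/-- Uncrossing: the intersection and the union of `A e` and `A f` both separate `p` from `q`, so
each has `e` or `f` in its boundary. This places the two edges so that one of the differences `A e \
A f`, `A f \ A e` has no edge of `M` in its boundary; that difference misses `p`, so it cannot
contain a node of the thread. -/
theorem not_crossing (h : IsCutSystem M A p q) {r s : Point G} (hr : r.IsNode) (hs : s.IsNode)
    (hrM : r ∈ thread M p) (hsM : s ∈ thread M p) {e f : M} (hef : e ≠ f)
    (h₁ : A e ∈ track r) (h₂ : A f ∉ track r) (h₃ : A e ∉ track s) (h₄ : A f ∈ track s) :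
    False := by
  have hfin := (h.finite e).union (h.finite f)
  have hef' := h.source_mem_iff_target_mem hef.symm
  have hfe' := h.source_mem_iff_target_mem hef
  have hbd : ∀ Z, boundary G Z ⊆ boundary G (A e) ∪ boundary G (A f) →
      ∀ g ∈ M, g ∈ boundary G Z → g = e ∨ g = f := fun Z hZ g hg hgZ =>
    (hZ hgZ).imp (h.eq_of_mem_boundary hg) (h.eq_of_mem_boundary hg)
  have hinter : source e.1 ∈ A f ∨ source f.1 ∈ A e := by
    have aux : ∀ {a b c d : Prop}, (c ↔ d) → ¬(a ∧ c ↔ b ∧ d) → c := by tauto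
    obtain ⟨g, hg, hgb⟩ := h.connects (A e ∩ A f) (hfin.subset (boundary_inter_subset _ _))
      ((mem_inter_iff _).2 ⟨h.mem e, h.mem f⟩) fun hc => h.notMem e ((mem_inter_iff _).1 hc).1
    rcases hbd _ (boundary_inter_subset _ _) g hg hgb with rfl | rfl
    · exact Or.inl (aux hfe' hgb)
    · rw [Set.inter_comm] at hgb
      exact Or.inr (aux hef' hgb)
  have hunion : source e.1 ∉ A f ∨ source f.1 ∉ A e := by
    have aux : ∀ {a b c d : Prop}, (c ↔ d) → ¬(a ∨ c ↔ b ∨ d) → ¬c := by tauto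
    obtain ⟨g, hg, hgb⟩ := h.connects (A e ∪ A f) (hfin.subset (boundary_union_subset _ _))
      (mem_of_superset (f := (track p : Filter V)) (h.mem e) Set.subset_union_left)
      fun hc => (Ultrafilter.union_mem_iff.1 hc).elim (h.notMem e) (h.notMem f)
    rcases hbd _ (boundary_union_subset _ _) g hg hgb with rfl | rfl
    · exact Or.inl (aux hfe' hgb)
    · rw [Set.union_comm] at hgb
      exact Or.inr (aux hef' hgb)
  have aux₁ : ∀ {a b c d : Prop}, (c ↔ d) → ¬(a ∧ ¬c ↔ b ∧ ¬d) → ¬c := by tauto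
  have aux₂ : ∀ {a b c d : Prop}, (c ↔ d) → ¬(c ∧ ¬a ↔ d ∧ ¬b) → c := by tauto
  by_cases hc : source e.1 ∈ A f
  · have := (hr.mem_thread.1 hrM (A e \ A f) (hfin.subset (boundary_diff_subset _ _))
      fun g hg hgb => (hbd _ (boundary_diff_subset _ _) g hg hgb).elim
        (fun hge => by subst hge; exact aux₁ hfe' hgb hc)
        fun hgf => by subst hgf; exact hunion.elim (· hc) (· (aux₂ hef' hgb))).1 ((mem_diff_iff _).2 ⟨h₁, h₂⟩)
    exact ((mem_diff_iff _).1 this).2 (h.mem f)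
  · have hsub : boundary G (A f \ A e) ⊆ boundary G (A e) ∪ boundary G (A f) := by
      rw [Set.union_comm]; exact boundary_diff_subset _ _
    have := (hs.mem_thread.1 hsM (A f \ A e) (hfin.subset hsub)
      fun g hg hgb => (hbd _ hsub g hg hgb).elim
        (fun hge => by subst hge; exact hc (aux₂ hfe' hgb))
        fun hgf => by subst hgf; exact hinter.elim hc (aux₁ hef' hgb)).1
      ((mem_diff_iff _).2 ⟨h₄, h₃⟩)
    exact ((mem_diff_iff _).1 this).2 (h.mem e)

/-- A node outside the thread is split off from `p` by a cut avoiding `M`. By `source_notMem` no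
edge of `M` lies on its side, so the whole cut neighbourhood misses the thread. -/
theorem isClosed_thread (h : IsCutSystem M A p q) : IsClosed (thread M p) := by
  rw [← isOpen_compl_iff, isOpen_iff_forall_mem_open]
  intro r hr
  by_cases hrn : r.IsNode
  · rw [Set.mem_compl_iff, hrn.mem_thread] at hr
    push Not at hr
    have : ∃ Z : Set V, (boundary G Z).Finite ∧ (∀ e ∈ M, e ∉ boundary G Z) ∧ Z ∈ track r ∧
        Z ∉ track p := by
      obtain ⟨Z, hZ, hM, ⟨h₁, h₂⟩ | ⟨h₁, h₂⟩⟩ := hr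
      · exact ⟨Z, hZ, hM, h₁, h₂⟩
      · exact ⟨Zᶜ, by rwa [boundary_compl], by rwa [boundary_compl],
          Ultrafilter.compl_mem_iff_notMem.2 h₁,
          fun hc => Ultrafilter.compl_mem_iff_notMem.1 hc h₂⟩
    obtain ⟨Z, hZ, hM, hZr, hZp⟩ := this
    let X : Set (G.edgeSet × Set.Ioo (0 : ℝ) 1) :=
      boundary G Z ×ˢ {⟨1 / 2, by norm_num, by norm_num⟩}
    refine ⟨cutOpen X Z, fun s hs hsM => ?_, isOpen_cutOpen (hZ.prod (Set.finite_singleton _))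
      fun e he => ⟨(e, _), ⟨he, rfl⟩, rfl⟩, hrn.mem_cutOpen.2 hZr⟩
    by_cases hsn : s.IsNode
    · exact hZp ((hsn.mem_thread.1 hsM Z hZ hM).1 (hsn.mem_cutOpen.1 hs))
    · cases s with
      | vertex v => exact hsn trivial
      | edgeEnd ω => exact hsn trivial
      | inner e t =>
        have he : source e ∉ Z := h.source_notMem hZ hM hZp ⟨e, hsM⟩
        rcases hs with hs | hs
        · exact he hs.1
        · exact he ((not_not.1 (hM e hsM)).2 hs.1)
  · cases r with
    | vertex v => exact (hrn trivial).elim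
    | edgeEnd ω => exact (hrn trivial).elim
    | inner e t =>
      refine ⟨Point.inner e '' Set.univ, ?_, isOpen_inner_image isOpen_univ, ⟨t, trivial, rfl⟩⟩
      rintro _ ⟨s, _, rfl⟩ hs
      exact hr hs

/-- Sort the edges of `M` by the size of a cut witnessing them and by the index from which the
sequences of `p` and `q` stay on their sides. Each class is finite: otherwise an ultralimit of the
witnessing cuts would still be a finite cut separating `p` from `q`, and an edge of `M` in it would
lie in the witnessing cuts of infinitely many different edges. -/
theorem countable (h : IsCutSystem M A p q) : M.Countable := by
  let S : ℕ × ℕ → Set M := fun k => {e | ∃ B : Set V, (boundary G B).Finite ∧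
    (boundary G B).ncard ≤ k.1 ∧ (∀ m, k.2 ≤ m → vertexSeq p m ∈ B) ∧
    (∀ m, k.2 ≤ m → vertexSeq q m ∉ B) ∧ ∀ f : M, f.1 ∈ boundary G B → f = e}
  have hS : ∀ k, (S k).Finite := by
    rintro ⟨k, n⟩
    by_contra hinf
    have : Infinite (S (k, n)) := Set.infinite_coe_iff.2 hinf
    choose B h₁ h₂ h₃ h₄ h₅ using fun i : S (k, n) => i.2
    let 𝒱 : Ultrafilter (S (k, n)) := hyperfilter _
    let L : Set V := {v | ∀ᶠ i in (𝒱 : Filter _), v ∈ B i}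
    have hL : ∀ e ∈ boundary G L, ∀ᶠ i in (𝒱 : Filter _), e ∈ boundary G (B i) := by
      intro e he
      by_contra hc
      rw [← Ultrafilter.eventually_not] at hc
      refine he ⟨fun h => ?_, fun h => ?_⟩
      · filter_upwards [hc, h] with i hi hi'
        exact (not_not.1 hi).1 hi'
      · filter_upwards [hc, h] with i hi hi'
        exact (not_not.1 hi).2 hi'
    -- Any `k + 1` boundary edges of the limit would lie together in the boundary of a single `B i`,
    -- which has at most `k` edges.
    have hLf : (boundary G L).Finite := by
      by_contra hLinf
      obtain ⟨T, hT, hTc⟩ := Set.Infinite.exists_subset_card_eq hLinf (k + 1)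
      have : ∀ᶠ i in (𝒱 : Filter _), ∀ e ∈ T, e ∈ boundary G (B i) :=
        (eventually_all_finset T).2 fun e he => hL e (hT he)
      obtain ⟨i, hi⟩ := this.exists
      have h := Set.ncard_le_ncard (s := (T : Set G.edgeSet)) hi (h₁ i)
      rw [Set.ncard_coe_finset, hTc] at h
      have := h₂ i
      omega
    have hp : L ∈ track p := mem_track_of_eventually (eventually_atTop.2
      ⟨n, fun m hm => Eventually.of_forall fun i => h₃ i m hm⟩)
    have hq : Lᶜ ∈ track q := mem_track_of_eventually (eventually_atTop.2
      ⟨n, fun m hm hc => by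
        obtain ⟨i, hi⟩ := hc.exists
        exact h₄ i m hm hi⟩)
    obtain ⟨f, hf, hfL⟩ := h.connects L hLf hp (Ultrafilter.compl_mem_iff_notMem.1 hq)
    have hev : {i : S (k, n) | (⟨f, hf⟩ : M) = i.1} ∈ 𝒱 :=
      mem_of_superset (f := (𝒱 : Filter _)) (hL f hfL) fun i hi => h₅ i ⟨f, hf⟩ hi
    exact (Set.Subsingleton.finite fun i hi j hj =>
      Subtype.ext (hi.symm.trans hj)).notMem_hyperfilter hev
  have hcov : (Set.univ : Set M) ⊆ ⋃ k, S k := by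
    intro e _
    have hp := (mem_track_iff_eventually (h.finite e)).1 (h.mem e)
    have hq := (mem_track_iff_eventually (A := (A e)ᶜ) (by rw [boundary_compl]; exact h.finite e)).1
      (Ultrafilter.compl_mem_iff_notMem.2 (h.notMem e))
    obtain ⟨n, hn⟩ := eventually_atTop.1 (hp.and hq)
    exact Set.mem_iUnion.2 ⟨((boundary G (A e)).ncard, n), A e, h.finite e, le_rfl,
      fun m hm => (hn m hm).1, fun m hm => (hn m hm).2, fun f hf => (h.mem_boundary_iff e f).1 hf⟩
  have : (Set.univ : Set M).Countable :=
    (Set.countable_iUnion fun k => (hS k).countable).mono hcov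
  exact Set.countable_coe_iff.1 (Set.countable_univ_iff.1 this)

end IsCutSystem

/-! ### Parametrising the thread by weighted cuts -/

theorem cutFun_inner_of_notMem {A : Set V} {e : G.edgeSet} (he : e ∉ boundary G A)
    (t : Set.Ioo (0 : ℝ) 1) :
    cutFun A (.inner e t) = cutFun A (.vertex (source e) : Point G) := by
  classical
  rw [cutFun_inner, (Point.isNode_vertex _).cutFun]
  simp only [mem_track_vertex, ← not_not.1 he]
  ring

theorem cutFun_inner_of_mem {A : Set V} {e : G.edgeSet} (he : e ∈ boundary G A) :
    (∀ t : Set.Ioo (0 : ℝ) 1, cutFun A (.inner e t) = t) ∨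
      ∀ t : Set.Ioo (0 : ℝ) 1, cutFun A (.inner e t) = 1 - t := by
  classical
  rw [mem_boundary] at he
  simp only [cutFun_inner]
  by_cases hs : source e ∈ A
  · have ht : target e ∉ A := fun ht => he ⟨fun _ => ht, fun _ => hs⟩
    left; simp [hs, ht]
  · have ht : target e ∈ A := by
      by_contra ht; exact he ⟨fun h => (hs h).elim, fun h => (ht h).elim⟩
    right; simp [hs, ht]

theorem Point.IsNode.cutFun_eq (A : Set V) {p : Point G} (hp : p.IsNode) :
    EdgeEnds.cutFun A p = 0 ∨ EdgeEnds.cutFun A p = 1 := by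
  classical
  rw [hp.cutFun]; split_ifs <;> simp

theorem Point.IsNode.mem_track_of_cutFun_lt {A : Set V} {p : Point G} (hp : p.IsNode)
    (h : EdgeEnds.cutFun A p < 1) : A ∈ track p := by
  by_contra hc
  rw [hp.cutFun, if_neg hc] at h
  exact lt_irrefl _ h

theorem Point.IsNode.notMem_track_of_cutFun_pos {A : Set V} {p : Point G} (hp : p.IsNode)
    (h : 0 < EdgeEnds.cutFun A p) : A ∉ track p := by
  intro hc
  rw [hp.cutFun, if_pos hc] at h
  exact lt_irrefl _ h

theorem cutFun_mem_Icc (A : Set V) (p : Point G) : cutFun A p ∈ Set.Icc (0 : ℝ) 1 := by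
  by_cases hp : p.IsNode
  · rcases hp.cutFun_eq A with h | h <;> rw [h] <;> simp
  · cases p with
    | vertex v => exact (hp trivial).elim
    | edgeEnd ω => exact (hp trivial).elim
    | inner e t =>
      by_cases he : e ∈ boundary G A
      · rcases cutFun_inner_of_mem he with h | h <;> rw [h]
        · exact ⟨t.2.1.le, t.2.2.le⟩
        · exact ⟨by linarith [t.2.2], by linarith [t.2.1]⟩
      · rw [cutFun_inner_of_notMem he]
        rcases (Point.isNode_vertex (G := G) (source e)).cutFun_eq A with h | h <;> rw [h] <;> simp

namespace IsCutSystem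

variable {M : Set G.edgeSet} {A : M → Set V} {p q : Point G}

/-- An inner point can be moved to an end of its edge: the edge crosses at most one of the two cuts,
and the end is chosen to suit that one. This transfers `not_crossing` from nodes to all points. -/
theorem exists_isNode (h : IsCutSystem M A p q) {r : Point G} (hr : r ∈ thread M p) {e f : M}
    (hef : e ≠ f) (he : cutFun (A e) r < 1) (hf : 0 < cutFun (A f) r) :
    ∃ r' : Point G, r'.IsNode ∧ r' ∈ thread M p ∧ A e ∈ track r' ∧ A f ∉ track r' := by
  by_cases hrn : r.IsNode
  · exact ⟨r, hrn, hr, hrn.mem_track_of_cutFun_lt he, hrn.notMem_track_of_cutFun_pos hf⟩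
  · cases r with
    | vertex v => exact (hrn trivial).elim
    | edgeEnd ω => exact (hrn trivial).elim
    | inner g t =>
      have hgM : g ∈ M := hr
      have hs := h.source_mem_thread ⟨g, hgM⟩
      have ht := h.target_mem_thread ⟨g, hgM⟩
      have hsn := Point.isNode_vertex (G := G) (source g)
      suffices (source g ∈ A e ∧ source g ∉ A f) ∨ (target g ∈ A e ∧ target g ∉ A f) by
        rcases this with h | h
        · exact ⟨_, Point.isNode_vertex _, hs, mem_track_vertex.2 h.1, fun hc =>
            h.2 (mem_track_vertex.1 hc)⟩
        · exact ⟨_, Point.isNode_vertex _, ht, mem_track_vertex.2 h.1, fun hc =>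
            h.2 (mem_track_vertex.1 hc)⟩
      have h₁ : g ∉ boundary G (A e) → source g ∈ A e ∧ target g ∈ A e := fun hg => by
        rw [cutFun_inner_of_notMem hg] at he
        have := mem_track_vertex.1 (hsn.mem_track_of_cutFun_lt he)
        exact ⟨this, (not_not.1 hg).1 this⟩
      have h₂ : g ∉ boundary G (A f) → source g ∉ A f ∧ target g ∉ A f := fun hg => by
        rw [cutFun_inner_of_notMem hg] at hf
        have : source g ∉ A f := fun hc =>
          hsn.notMem_track_of_cutFun_pos hf (mem_track_vertex.2 hc)
        exact ⟨this, fun hc => this ((not_not.1 hg).2 hc)⟩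
      by_cases hge : g ∈ boundary G (A e)
      · have hgf : g ∉ boundary G (A f) := fun hgf => hef (Subtype.ext
          ((h.eq_of_mem_boundary hgM hge).symm.trans (h.eq_of_mem_boundary hgM hgf)))
        rw [mem_boundary] at hge
        have := h₂ hgf
        tauto
      · have := h₁ hge
        by_cases hgf : g ∈ boundary G (A f)
        · rw [mem_boundary] at hgf
          tauto
        · have := h₂ hgf
          tauto

theorem cutFun_le_or_ge (h : IsCutSystem M A p q) {r s : Point G} (hr : r ∈ thread M p)
    (hs : s ∈ thread M p) :
    (∀ e, cutFun (A e) r ≤ cutFun (A e) s) ∨ ∀ e, cutFun (A e) s ≤ cutFun (A e) r := by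
  by_contra! hc
  obtain ⟨⟨f, hf⟩, e, he⟩ := hc
  have hef : e ≠ f := by rintro rfl; exact lt_asymm hf he
  have h0 := fun e r => (cutFun_mem_Icc (G := G) (A e) r).1
  have h1 := fun e r => (cutFun_mem_Icc (G := G) (A e) r).2
  obtain ⟨r', hrn, hr', h₁, h₂⟩ := h.exists_isNode hr hef (he.trans_le (h1 _ _))
    ((h0 _ _).trans_lt hf)
  obtain ⟨s', hsn, hs', h₃, h₄⟩ := h.exists_isNode hs hef.symm (hf.trans_le (h1 _ _))
    ((h0 _ _).trans_lt he)
  exact h.not_crossing hrn hsn hr' hs' hef h₁ h₂ h₄ h₃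

/-- Two nodes are handled by `exists_not_iff`. For an inner point of `g ∈ M`, the cut of `g` itself
works: its function lies strictly between 0 and 1 and is injective on the open edge `g`, and
elsewhere on the thread it is 0 or 1. -/
theorem exists_cutFun_ne (h : IsCutSystem M A p q) {r s : Point G} (hr : r ∈ thread M p)
    (hs : s ∈ thread M p) (hrs : ¬Inseparable r s) : ∃ e, cutFun (A e) r ≠ cutFun (A e) s := by
  have key : ∀ {g t} {s : Point G}, Point.inner g t ∈ thread M p → s ∈ thread M p →
      s ≠ .inner g t → ∃ e, cutFun (A e) (.inner g t) ≠ cutFun (A e) s := by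
    intro g t s hg hsM hs
    have hb := h.self_mem_boundary ⟨g, hg⟩
    refine ⟨⟨g, hg⟩, fun heq => ?_⟩
    have hne : cutFun (A ⟨g, hg⟩) (.inner g t) ≠ 0 ∧ cutFun (A ⟨g, hg⟩) (.inner g t) ≠ 1 := by
      have h₀ := t.2.1
      have h₁ := t.2.2
      rcases cutFun_inner_of_mem hb with h | h <;> rw [h] <;> constructor <;> intro hc <;> linarith
    have hnode : ∀ {s : Point G}, s.IsNode → cutFun (A ⟨g, hg⟩) (.inner g t) ≠ cutFun (A ⟨g, hg⟩) s :=
      fun hsn hc => (hsn.cutFun_eq (A ⟨g, hg⟩)).elim (fun h => hne.1 (hc.trans h))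
        fun h => hne.2 (hc.trans h)
    cases s with
    | vertex v => exact hnode (Point.isNode_vertex v) heq
    | edgeEnd ω => exact hnode (Point.isNode_edgeEnd ω) heq
    | inner g' t' =>
      by_cases hg' : g' ∈ boundary G (A ⟨g, hg⟩)
      · by_cases hgg : g' = g
        · subst hgg
          refine hs (congrArg _ (Subtype.ext ?_))
          rcases cutFun_inner_of_mem hb with h | h <;> rw [h, h] at heq <;> linarith
        · exact hgg (h.eq_of_mem_boundary (inner_mem_thread.1 hsM) hg')
      · rw [cutFun_inner_of_notMem hg'] at heq
        exact hnode (Point.isNode_vertex _) heq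
  by_cases hrn : r.IsNode
  · by_cases hsn : s.IsNode
    · obtain ⟨e, he⟩ := h.exists_not_iff hrn hsn hr hs hrs
      refine ⟨e, fun hc => he ?_⟩
      rw [hrn.cutFun, hsn.cutFun] at hc
      by_cases h₁ : A e ∈ track r <;> by_cases h₂ : A e ∈ track s <;> simp_all
    · cases s with
      | inner g t =>
        obtain ⟨e, he⟩ := key hs hr (by rintro rfl; exact hrn)
        exact ⟨e, he.symm⟩
      | vertex v => exact (hsn trivial).elim
      | edgeEnd ω => exact (hsn trivial).elim
  · cases r with
    | inner g t => exact key hr hs fun hc => hrs (by rw [hc])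
    | vertex v => exact (hrn trivial).elim
    | edgeEnd ω => exact (hrn trivial).elim

/-- The weighted sum of the cut functions of a cut system. -/
noncomputable def weight (A : M → Set V) (w : M → ℝ) (r : Point G) : ℝ :=
  ∑' e, w e * cutFun (A e) r

variable {w : M → ℝ}

theorem summable_weight (hw : ∀ e, 0 < w e) (hs : Summable w) (r : Point G) :
    Summable fun e => w e * cutFun (A e) r :=
  hs.of_nonneg_of_le (fun e => mul_nonneg (hw e).le (cutFun_mem_Icc _ _).1)
    fun e => mul_le_of_le_one_right (hw e).le (cutFun_mem_Icc _ _).2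

theorem continuous_weight (h : IsCutSystem M A p q) (hw : ∀ e, 0 < w e) (hs : Summable w) :
    Continuous (weight A w : Point G → ℝ) := by
  refine continuous_tsum (fun e => continuous_const.mul (continuous_cutFun (h.finite e))) hs
    fun e r => ?_
  rw [Real.norm_of_nonneg (mul_nonneg (hw e).le (cutFun_mem_Icc _ _).1)]
  exact mul_le_of_le_one_right (hw e).le (cutFun_mem_Icc _ _).2

/-- Points of the thread are comparable in all cut functions at once, so one differing coordinate
with its positive weight already makes the sums differ. -/
theorem inseparable_of_weight_eq (h : IsCutSystem M A p q) (hw : ∀ e, 0 < w e) (hs : Summable w)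
    {r s : Point G} (hr : r ∈ thread M p) (hsM : s ∈ thread M p)
    (heq : weight A w r = weight A w s) : Inseparable r s := by
  have key : ∀ {r s : Point G}, (∀ e, cutFun (A e) r ≤ cutFun (A e) s) →
      (∃ e, cutFun (A e) r ≠ cutFun (A e) s) → weight A w r < weight A w s := by
    rintro r s hle ⟨e, he⟩
    exact Summable.tsum_lt_tsum (i := e)
      (fun e => mul_le_mul_of_nonneg_left (hle e) (hw e).le)
      (mul_lt_mul_of_pos_left (lt_of_le_of_ne (hle e) he) (hw e))
      (summable_weight hw hs r) (summable_weight hw hs s)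
  by_contra hrs
  obtain ⟨e, he⟩ := h.exists_cutFun_ne hr hsM hrs
  rcases h.cutFun_le_or_ge hr hsM with hle | hle
  · exact (key hle ⟨e, he⟩).ne heq
  · exact (key hle ⟨e, he.symm⟩).ne heq.symm

theorem weight_mem_Icc (hw : ∀ e, 0 < w e) (hs : Summable w) (r : Point G) :
    weight A w r ∈ Set.Icc 0 (∑' e, w e) :=
  ⟨tsum_nonneg fun e => mul_nonneg (hw e).le (cutFun_mem_Icc _ _).1,
    Summable.tsum_le_tsum (fun e => mul_le_of_le_one_right (hw e).le (cutFun_mem_Icc _ _).2)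
      (summable_weight hw hs r) hs⟩

theorem weight_left (h : IsCutSystem M A p q) (hp : p.IsNode) : weight A w p = 0 := by
  have : ∀ e, w e * cutFun (A e) p = 0 := fun e => by
    rw [hp.cutFun, if_pos (h.mem e), mul_zero]
  simp [weight, this]

theorem weight_right (h : IsCutSystem M A p q) (hq : q.IsNode) : weight A w q = ∑' e, w e := by
  have : ∀ e, w e * cutFun (A e) q = w e := fun e => by
    rw [hq.cutFun, if_neg (h.notMem e), mul_one]
  simp [weight, this]

/-- Along `e` only the cut function of `A e` varies, and it runs through the open unit interval; `a`
is the constant sum of the other terms. -/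
theorem exists_Ioo_subset (h : IsCutSystem M A p q) (hw : ∀ e, 0 < w e) (hs : Summable w) (e : M) :
    ∃ a, Set.Ioo a (a + w e) ⊆ weight A w '' Set.range (Point.inner e.1) := by
  classical
  refine ⟨∑' f, if f = e then 0 else w f * cutFun (A f) (.vertex (source e.1) : Point G), ?_⟩
  intro x hx
  set a := ∑' f, if f = e then 0 else w f * cutFun (A f) (.vertex (source e.1) : Point G) with ha
  have hval : ∀ t, weight A w (.inner e.1 t) = w e * cutFun (A e) (.inner e.1 t) + a := by
    intro t
    rw [weight, (summable_weight hw hs _).tsum_eq_add_tsum_ite e, ha]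
    congr 1
    refine tsum_congr fun f => ?_
    split_ifs with hf
    · rfl
    · rw [cutFun_inner_of_notMem fun hc => hf ((h.mem_boundary_iff f e).1 hc).symm]
  have h₀ : 0 < (x - a) / w e := div_pos (by linarith [hx.1]) (hw e)
  have h₁ : (x - a) / w e < 1 := (div_lt_one (hw e)).2 (by linarith [hx.2])
  have hx' : w e * ((x - a) / w e) + a = x := by
    rw [mul_div_cancel₀ _ (hw e).ne']; ring
  rcases cutFun_inner_of_mem (h.self_mem_boundary e) with hc | hc
  · exact ⟨_, ⟨⟨(x - a) / w e, h₀, h₁⟩, rfl⟩, by rw [hval, hc]; exact hx'⟩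
  · refine ⟨_, ⟨⟨1 - (x - a) / w e, by linarith, by linarith⟩, rfl⟩, ?_⟩
    rw [hval, hc]
    simpa using hx'

theorem image_weight (h : IsCutSystem M A p q) (hG : G.Connected) (hp : p.IsNode) (hq : q.IsNode)
    (hw : ∀ e, 0 < w e) (hs : Summable w) :
    weight A w '' thread M p = Set.Icc 0 (∑' e, w e) := by
  have := compactSpace_point hG
  have := h.countable.to_subtype
  refine Set.Subset.antisymm (by rintro _ ⟨r, _, rfl⟩; exact weight_mem_Icc hw hs r) ?_
  have hclosed : IsClosed (weight A w '' thread M p) :=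
    (h.isClosed_thread.isCompact.image (h.continuous_weight hw hs)).isClosed
  choose a ha using h.exists_Ioo_subset hw hs
  have hsub : ∀ e, Set.Ioo (a e) (a e + w e) ⊆ weight A w '' thread M p := fun e =>
    (ha e).trans (Set.image_mono (by rintro _ ⟨t, rfl⟩; exact e.2))
  have hdisj : Pairwise (Function.onFun Disjoint fun e => Set.Ioo (a e) (a e + w e)) := by
    intro e f hef
    refine Set.disjoint_left.2 fun x hxe hxf => hef ?_
    obtain ⟨_, ⟨t, rfl⟩, ht⟩ := ha e hxe
    obtain ⟨_, ⟨s, rfl⟩, hs'⟩ := ha f hxf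
    have := eq_of_inseparable_inner
      (h.inseparable_of_weight_eq hw hs (inner_mem_thread.2 e.2) (inner_mem_thread.2 f.2)
        (ht.trans hs'.symm))
    injection this with h₁ _
    exact Subtype.ext h₁
  have hvol : MeasureTheory.volume (⋃ e, Set.Ioo (a e) (a e + w e)) =
      ENNReal.ofReal (∑' e, w e) := by
    rw [MeasureTheory.measure_iUnion hdisj fun e => measurableSet_Ioo]
    simp only [Real.volume_Ioo, add_sub_cancel_left]
    exact (ENNReal.ofReal_tsum_of_nonneg (fun e => (hw e).le) hs).symm
  have hIoo : Set.Ioo 0 (∑' e, w e) ⊆ weight A w '' thread M p := by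
    -- A missed value would leave a nonempty open set of positive measure beside the disjoint edge
    -- intervals, which already have the measure of the whole interval.
    by_contra hc
    obtain ⟨x, hx, hxn⟩ := Set.not_subset.1 hc
    have hO : IsOpen (Set.Ioo 0 (∑' e, w e) \ (weight A w '' thread M p)) :=
      isOpen_Ioo.sdiff hclosed
    have hpos := hO.measure_pos MeasureTheory.volume ⟨x, hx, hxn⟩
    have hle : MeasureTheory.volume ((⋃ e, Set.Ioo (a e) (a e + w e)) ∪
        (Set.Ioo 0 (∑' e, w e) \ (weight A w '' thread M p))) ≤
        MeasureTheory.volume (Set.Icc 0 (∑' e, w e)) := by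
      refine MeasureTheory.measure_mono (Set.union_subset (Set.iUnion_subset fun e y hy => ?_)
        (Set.sdiff_subset.trans Set.Ioo_subset_Icc_self))
      obtain ⟨r, _, rfl⟩ := hsub e hy
      exact weight_mem_Icc hw hs r
    rw [MeasureTheory.measure_union (Set.disjoint_left.2 fun y hy hy' => by
        obtain ⟨e, he⟩ := Set.mem_iUnion.1 hy
        exact hy'.2 (hsub e he)) hO.measurableSet, hvol, Real.volume_Icc, sub_zero] at hle
    exact absurd hle (not_le.2 (ENNReal.lt_add_right ENNReal.ofReal_ne_top hpos.ne'))
  intro x hx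
  rcases hx.1.eq_or_lt with rfl | h₀
  · exact ⟨p, left_mem_thread hp, h.weight_left hp⟩
  rcases hx.2.eq_or_lt with rfl | h₁
  · exact ⟨q, h.right_mem_thread hq, h.weight_right hq⟩
  exact hIoo ⟨h₀, h₁⟩

end IsCutSystem

/-! ### From cuts to arcs in closed sets -/

theorem continuousOn_invFunOn {Y : Type*} [TopologicalSpace Y] [Nonempty Y] {C : Set Y}
    (hC : IsCompact C) {ψ : Y → ℝ} (hψ : Continuous ψ) (hinj : Set.InjOn ψ C) :
    ContinuousOn (Function.invFunOn ψ C) (ψ '' C) := by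
  rw [continuousOn_iff_isClosed]
  intro D hD
  refine ⟨ψ '' (C ∩ D), ((hC.inter_right hD).image hψ).isClosed, ?_⟩
  ext x
  constructor
  · rintro ⟨hx, y, hy, rfl⟩
    rw [Set.mem_preimage, hinj.leftInvOn_invFunOn hy] at hx
    exact ⟨⟨y, ⟨hy, hx⟩, rfl⟩, y, hy, rfl⟩
  · rintro ⟨⟨y, hy, rfl⟩, hx⟩
    refine ⟨?_, hx⟩
    rw [Set.mem_preimage, hinj.leftInvOn_invFunOn hy.1]
    exact hy.2

theorem arcJoined_of_connects (hG : G.Connected) {H : Set (GTilde G)} (hH : IsClosed H)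
    {p q : Point G} (hp : p.IsNode) (hq : q.IsNode) (hpH : SeparationQuotient.mk p ∈ H)
    (hE : Connects {e | edgePts e ⊆ H} p q) :
    ArcJoined H (SeparationQuotient.mk p) (SeparationQuotient.mk q) := by
  obtain ⟨M, hME, A, h⟩ := hE.exists_isCutSystem
  have := compactSpace_point hG
  have := h.countable.to_subtype
  have : Nonempty (GTilde G) := ⟨SeparationQuotient.mk p⟩
  have := Encodable.ofCountable M
  obtain ⟨w, hw, c, hwc, -⟩ := posSumOfEncodable (ε := 1) one_pos M
  have hs := hwc.summable
  let ψ : GTilde G → ℝ := SeparationQuotient.lift (IsCutSystem.weight A w)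
    fun _ _ hrs => apply_eq_of_inseparable (h.continuous_weight hw hs) hrs
  have hψ : Continuous ψ := SeparationQuotient.continuous_lift (h.continuous_weight hw hs)
  have hC : IsCompact (SeparationQuotient.mk '' thread M p : Set (GTilde G)) :=
    h.isClosed_thread.isCompact.image SeparationQuotient.continuous_mk
  have hinj : Set.InjOn ψ (SeparationQuotient.mk '' thread M p) := by
    rintro _ ⟨r, hr, rfl⟩ _ ⟨s, hsM, rfl⟩ hrs
    exact SeparationQuotient.mk_eq_mk.2 (h.inseparable_of_weight_eq hw hs hr hsM hrs)
  have himage : ψ '' (SeparationQuotient.mk '' thread M p) = Set.Icc 0 (∑' e, w e) := by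
    rw [← h.image_weight hG hp hq hw hs, Set.image_image]; rfl
  have hinv := hinj.leftInvOn_invFunOn
  have hcont := continuousOn_invFunOn hC hψ hinj
  have hright : Set.InjOn (Function.invFunOn ψ (SeparationQuotient.mk '' thread M p))
      (ψ '' (SeparationQuotient.mk '' thread M p)) := (Set.surjOn_image _ _).rightInvOn_invFunOn.injOn
  have hmaps : Set.MapsTo (Function.invFunOn ψ (SeparationQuotient.mk '' thread M p))
      (ψ '' (SeparationQuotient.mk '' thread M p)) H := by
    rintro _ ⟨y, hy, rfl⟩
    rw [hinv hy]
    obtain ⟨r, hr, rfl⟩ := hy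
    exact mk_mem_of_mem_thread hH hp hpH hME hr
  rw [himage] at hcont hright hmaps
  refine ⟨_, 0, ∑' e, w e, tsum_nonneg fun e => (hw e).le, hcont, hright, ?_, ?_, hmaps⟩
  · rw [← h.weight_left (w := w) hp]
    exact hinv ⟨p, IsCutSystem.left_mem_thread hp, rfl⟩
  · rw [← h.weight_right (w := w) hq]
    exact hinv ⟨q, h.right_mem_thread hq, rfl⟩

/-! ### Standard subspaces and the two implications -/

theorem IsStandardSubspace.isClosed {H : Set (GTilde G)} (hH : IsStandardSubspace H) :
    IsClosed H := by
  obtain ⟨S, rfl⟩ := hH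
  exact isClosed_closure

/-- An open edge is open in the space, so it already meets the subgraph; its points are identified
with no others, so the edge belongs to the subgraph. -/
theorem IsStandardSubspace.edgePts_subset {H : Set (GTilde G)} (hH : IsStandardSubspace H)
    {e : G.edgeSet} {t : Set.Ioo (0 : ℝ) 1} (h : SeparationQuotient.mk (.inner e t) ∈ H) :
    edgePts e ⊆ H := by
  obtain ⟨S, rfl⟩ := hH
  have hO : IsOpen (SeparationQuotient.mk '' (Point.inner e '' Set.univ) : Set (GTilde G)) :=
    SeparationQuotient.isOpenMap_mk _ (isOpen_inner_image isOpen_univ)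
  obtain ⟨_, ⟨_, ⟨s, _, rfl⟩, rfl⟩, hs⟩ :=
    mem_closure_iff.1 h _ hO ⟨_, ⟨t, trivial, rfl⟩, rfl⟩
  suffices e.1 ∈ S.edgeSet from fun x hx =>
    subset_closure (Or.inr (Set.mem_iUnion₂.2 ⟨e, this, hx⟩))
  have hnv : ∀ v, (vertexPt v : GTilde G) ≠ SeparationQuotient.mk (.inner e s) := fun v hv => by
    have := eq_of_inseparable_inner (SeparationQuotient.mk_eq_mk.1 hv)
    cases this
  rcases hs with ⟨v, _, hv⟩ | hs
  · exact (hnv v hv).elim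
  · obtain ⟨f, hf, hs⟩ := Set.mem_iUnion₂.1 hs
    rcases hs with (hs | hs) | ⟨s', hs⟩
    · exact (hnv _ hs.symm).elim
    · exact (hnv _ (Set.mem_singleton_iff.1 hs).symm).elim
    · have := eq_of_inseparable_inner (SeparationQuotient.mk_eq_mk.1 hs)
      injection this with h₁ _
      exact h₁ ▸ hf

/-- The cut neighbourhood of `p` meets the subgraph in a vertex of `A` or on an edge with an end in
`A`. So a cut separating two nodes of `H` has vertices of `H` on both sides, and the hypothesis on
cuts applies. -/
theorem IsStandardSubspace.exists_vertexPt_mem {H : Set (GTilde G)} (hH : IsStandardSubspace H)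
    {p : Point G} (hp : p.IsNode) (hpH : SeparationQuotient.mk p ∈ H) {A : Set V}
    (hA : (boundary G A).Finite) (hpA : A ∈ track p) : ∃ a ∈ A, vertexPt a ∈ H := by
  obtain ⟨S, rfl⟩ := hH
  let X : Set (G.edgeSet × Set.Ioo (0 : ℝ) 1) :=
    boundary G A ×ˢ {⟨1 / 2, by norm_num, by norm_num⟩}
  have hO : IsOpen (cutOpen X A) := isOpen_cutOpen (hA.prod (Set.finite_singleton _))
    fun e he => ⟨(e, _), ⟨he, rfl⟩, rfl⟩
  obtain ⟨x, hx, hxS⟩ := mem_closure_iff.1 hpH _ (SeparationQuotient.isOpenMap_mk _ hO)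
    ⟨p, hp.mem_cutOpen.2 hpA, rfl⟩
  have hvert : ∀ v, (vertexPt v : GTilde G) ∈ SeparationQuotient.mk '' cutOpen X A → v ∈ A :=
    fun v hv => vertex_mem_cutOpen.1 (mem_of_mk_mem_image hO hv)
  rcases hxS with ⟨v, hv, rfl⟩ | hxS
  · exact ⟨v, hvert v hx, subset_closure (Or.inl ⟨v, hv, rfl⟩)⟩
  · obtain ⟨e, he, hxe⟩ := Set.mem_iUnion₂.1 hxS
    have hsub : edgePts e ⊆ closure (subgraphPts S) := fun y hy =>
      subset_closure (Or.inr (Set.mem_iUnion₂.2 ⟨e, he, hy⟩))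
    have hs := hsub (Or.inl (Or.inl rfl))
    have ht := hsub (Or.inl (Or.inr rfl))
    rcases hxe with (rfl | rfl) | ⟨t, rfl⟩
    · exact ⟨_, hvert _ hx, hs⟩
    · exact ⟨_, hvert _ hx, ht⟩
    · rcases mem_of_mk_mem_image hO hx with h | h
      · exact ⟨_, h.1, hs⟩
      · exact ⟨_, h.1, ht⟩

theorem isArcConnected_of_cuts (hG : G.Connected) {H : Set (GTilde G)}
    (hH : IsStandardSubspace H)
    (h : ∀ A B : Set V, IsFiniteCut G A B → (∃ a ∈ A, vertexPt a ∈ H) →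
      (∃ b ∈ B, vertexPt b ∈ H) → ∃ e : G.edgeSet, e.1 ∈ cutEdges G A B ∧ edgePts e ⊆ H) :
    IsArcConnected H := by
  have hnode : ∀ p q : Point G, p.IsNode → q.IsNode → SeparationQuotient.mk p ∈ H →
      SeparationQuotient.mk q ∈ H →
      ArcJoined H (SeparationQuotient.mk p) (SeparationQuotient.mk q) := by
    intro p q hp hq hpH hqH
    refine arcJoined_of_connects hG hH.isClosed hp hq hpH fun A hA hpA hqA => ?_
    obtain ⟨e, he, heH⟩ := h A Aᶜ ⟨Set.inter_compl_self A, Set.union_compl_self A,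
      (finite_cutEdges_iff A).2 hA⟩ (hH.exists_vertexPt_mem hp hpH hA hpA)
      (hH.exists_vertexPt_mem hq hqH (by rwa [boundary_compl])
        (Ultrafilter.compl_mem_iff_notMem.2 hqA))
    rw [← image_boundary] at he
    obtain ⟨f, hf, hfe⟩ := he
    rw [Subtype.ext hfe] at hf
    exact ⟨e, heH, hf⟩
  have hred : ∀ x ∈ H, ∃ p : Point G, p.IsNode ∧ SeparationQuotient.mk p ∈ H ∧
      ArcJoined H x (SeparationQuotient.mk p) := by
    intro x hx
    obtain ⟨p, rfl⟩ := SeparationQuotient.surjective_mk x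
    by_cases hp : p.IsNode
    -- No cut separates `p` from itself; this is the degenerate arc.
    · exact ⟨p, hp, hx, hnode p p hp hp hx hx⟩
    · cases p with
      | vertex v => exact (hp trivial).elim
      | edgeEnd ω => exact (hp trivial).elim
      | inner e t =>
        have he := hH.edgePts_subset hx
        exact ⟨.vertex (source e), trivial, he (Or.inl (Or.inl rfl)),
          (arcJoined_inner_source e t).mono he⟩
  refine isArcConnected_of_arcJoined fun x hx y hy => ?_
  obtain ⟨p, hp, hpH, hxp⟩ := hred x hx
  obtain ⟨q, hq, hqH, hyq⟩ := hred y hy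
  exact (hxp.trans (hnode p q hp hq hpH hqH)).trans hyq.symm

theorem exists_edgePts_subset_of_isArcConnected {H : Set (GTilde G)} (hH : IsClosed H)
    (harc : IsArcConnected H) {A : Set V} (hA : (boundary G A).Finite) {a b : V} (ha : a ∈ A)
    (haH : vertexPt a ∈ H) (hb : b ∉ A) (hbH : vertexPt b ∈ H) :
    ∃ e ∈ boundary G A, edgePts e ⊆ H := by
  by_contra! hc
  have : ∀ e ∈ boundary G A, ∃ t, (SeparationQuotient.mk (.inner e t) : GTilde G) ∉ H := by
    intro e he
    by_contra! ht
    exact hc e he (edgePts_subset hH ht)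
  have : Nonempty (Set.Ioo (0 : ℝ) 1) := ⟨⟨1 / 2, by norm_num, by norm_num⟩⟩
  choose! τ hτ using ‹∀ e ∈ boundary G A, _›
  -- Cutting each boundary edge at a single point outside `H` makes the two sides disjoint while
  -- still covering `H`.
  let X : Set (G.edgeSet × Set.Ioo (0 : ℝ) 1) := (fun e => (e, τ e)) '' boundary G A
  have hX : X.Finite := hA.image _
  have hAX : boundary G A ⊆ Prod.fst '' X := fun e he => ⟨_, ⟨e, he, rfl⟩, rfl⟩
  have hO₁ : IsOpen (cutOpen X A) := isOpen_cutOpen hX hAX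
  have hO₂ : IsOpen (cutOpen X Aᶜ) := isOpen_cutOpen hX (by rwa [boundary_compl])
  have hXe : ∀ {e : G.edgeSet} {s}, (e, s) ∈ X → e ∈ boundary G A ∧ s = τ e := by
    rintro e s ⟨f, hf, hfe⟩
    obtain ⟨rfl, rfl⟩ := Prod.ext_iff.1 hfe
    exact ⟨hf, rfl⟩
  have hdisj : Disjoint (cutOpen X A) (cutOpen X Aᶜ) := by
    refine Set.disjoint_left.2 fun r h₁ h₂ => ?_
    cases r with
    | vertex v => exact h₂ h₁
    | edgeEnd ω => exact Ultrafilter.compl_mem_iff_notMem.1 (edgeEnd_mem_cutOpen.1 h₂) h₁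
    | inner e t =>
      by_cases he : e ∈ boundary G A
      · have hmem : (e, τ e) ∈ X := ⟨e, he, rfl⟩
        rcases h₁ with ⟨h₁, h₁'⟩ | ⟨h₁, h₁'⟩ <;> rcases h₂ with ⟨h₂, h₂'⟩ | ⟨h₂, h₂'⟩
        · exact h₂ h₁
        · exact lt_asymm (h₁' _ hmem) (h₂' _ hmem)
        · exact lt_asymm (h₁' _ hmem) (h₂' _ hmem)
        · exact h₂ h₁
      · have he' := not_not.1 he
        have h₁' : source e ∈ A := h₁.elim (·.1) fun h => he'.2 h.1
        have h₂' : source e ∉ A := h₂.elim (·.1) fun h hs => h.1 (he'.1 hs)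
        exact h₂' h₁'
  have hcov : ∀ r : Point G, SeparationQuotient.mk r ∈ H → r ∈ cutOpen X A ∪ cutOpen X Aᶜ := by
    intro r hr
    cases r with
    | vertex v => exact em (v ∈ A)
    | edgeEnd ω =>
      by_cases h : A ∈ track (Point.edgeEnd ω)
      · exact Or.inl h
      · exact Or.inr (edgeEnd_mem_cutOpen.2 (Ultrafilter.compl_mem_iff_notMem.2 h))
    | inner e t =>
      by_cases he : e ∈ boundary G A
      · have hne : t ≠ τ e := fun h => hτ e he (h ▸ hr)
        rcases hne.lt_or_gt with hlt | hlt
        · have hlt' : ∀ s, (e, s) ∈ X → t < s := fun s hs => (hXe hs).2 ▸ hlt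
          by_cases hs : source e ∈ A
          · exact Or.inl (Or.inl ⟨hs, hlt'⟩)
          · exact Or.inr (Or.inl ⟨hs, hlt'⟩)
        · have hlt' : ∀ s, (e, s) ∈ X → s < t := fun s hs => (hXe hs).2 ▸ hlt
          by_cases hs : target e ∈ A
          · exact Or.inl (Or.inr ⟨hs, hlt'⟩)
          · exact Or.inr (Or.inr ⟨hs, hlt'⟩)
      · have hlt' : ∀ s, (e, s) ∈ X → t < s := fun s hs => (he (hXe hs).1).elim
        by_cases hs : source e ∈ A
        · exact Or.inl (Or.inl ⟨hs, hlt'⟩)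
        · exact Or.inr (Or.inl ⟨hs, hlt'⟩)
  have hab : (vertexPt a : GTilde G) ≠ vertexPt b := fun h => hb (vertex_mem_cutOpen.1
    (((SeparationQuotient.mk_eq_mk.1 h).mem_open_iff hO₁).1 (vertex_mem_cutOpen.2 ha)))
  obtain ⟨γ, hγ, hγ₀, hγ₁, hγH⟩ := harc _ haH _ hbH hab
  have hconn : IsPreconnected (Set.range γ) := isPreconnected_range hγ.continuous
  obtain ⟨x, _, ⟨r, hr, rfl⟩, hx₂⟩ := hconn (SeparationQuotient.mk '' cutOpen X A)
    (SeparationQuotient.mk '' cutOpen X Aᶜ) (SeparationQuotient.isOpenMap_mk _ hO₁)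
    (SeparationQuotient.isOpenMap_mk _ hO₂) (fun x hx => by
      obtain ⟨r, rfl⟩ := SeparationQuotient.surjective_mk x
      exact (hcov r (hγH hx)).imp (fun h => ⟨r, h, rfl⟩) fun h => ⟨r, h, rfl⟩)
    ⟨_, ⟨0, hγ₀⟩, .vertex a, vertex_mem_cutOpen.2 ha, rfl⟩
    ⟨_, ⟨1, hγ₁⟩, .vertex b, vertex_mem_cutOpen.2 hb, rfl⟩
  exact Set.disjoint_left.1 hdisj hr (mem_of_mk_mem_image hO₂ hx₂)

end EdgeEnds

theorem mainTheorem8 {V : Type*} (G : SimpleGraph V) (hG : G.Connected)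
    (H : Set (EdgeEnds.GTilde G)) (hH : EdgeEnds.IsStandardSubspace H) :
    EdgeEnds.IsArcConnected H ↔
      ∀ A B : Set V, EdgeEnds.IsFiniteCut G A B →
        (∃ a ∈ A, EdgeEnds.vertexPt a ∈ H) → (∃ b ∈ B, EdgeEnds.vertexPt b ∈ H) →
          ∃ e : G.edgeSet, e.1 ∈ EdgeEnds.cutEdges G A B ∧ EdgeEnds.edgePts e ⊆ H := by
  refine ⟨?_, EdgeEnds.isArcConnected_of_cuts hG hH⟩
  rintro harc A B ⟨hdisj, hunion, hfin⟩ ⟨a, ha, haH⟩ ⟨b, hb, hbH⟩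
  obtain rfl : B = Aᶜ := by
    ext v
    have h₁ : v ∈ A ∪ B := hunion ▸ trivial
    refine ⟨fun hvB hvA => ?_, fun hvA => h₁.resolve_left hvA⟩
    have : v ∈ A ∩ B := ⟨hvA, hvB⟩
    rwa [hdisj] at this
  obtain ⟨e, he, heH⟩ := EdgeEnds.exists_edgePts_subset_of_isArcConnected hH.isClosed harc
    ((EdgeEnds.finite_cutEdges_iff A).1 hfin) ha haH hb hbH
  exact ⟨e, EdgeEnds.image_boundary A ▸ ⟨e, he, rfl⟩, heH⟩
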